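/- **Proposition 3.2.** Let $n\ge 1$, and let $\Sigma_{S^n}$ be the octahedral simplicial model of the $n$-sphere: its vertices are $0^+,\dots,n^+,0^-,\dots,n^-$, and its simplexes are the non-empty sets of vertices that contain no pair $\{i^+,i^-\}$, $0\le i\le n$. Let $S_n^{nc}$ be the flag algebra of $\Sigma_{S^n}$, i.e. the universal unital $C^*$-algebra with positive generators $h_s$, $s$ a vertex of $\Sigma_{S^n}$, subject to the relations $$h_{i^+}h_{i^-}=0=h_{i^-}h_{i^+}\quad(0\le i\le n),\qquad \sum_{i=0}^n (h_{i^+}+h_{i^-})=1 .$$ For every vertex $s$ let $\mathrm{ev}_s:S_n^{nc}\to\mathbb{C}$ be the evaluation map at $s$, i.e. the $*$-homomorphism with $\mathrm{ev}_s(h_s)=1$ and $\mathrm{ev}_s(h_t)=0$ for all vertices $t\ne s$. Then, for every vertex $s$, the map $\mathrm{ev}_s$ induces an isomorphism $K_*(S_n^{nc})\to K_*(\mathbb{C})$ in $C^*$-algebraic $K$-theory; that is, both $K_0(\mathrm{ev}_s):K_0(S_n^{nc})\to K_0(\mathbb{C})$ and $K_1(\mathrm{ev}_s):K_1(S_n^{nc})\to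 K_1(\mathbb{C})$ are group isomorphisms. -/

import Mathlib

namespace NCFlag

section Universal
open scoped ENNReal

/-- A family `(h s)` of elements of a unital C*-algebra, indexed by the vertices of a finite simplicial
complex `K`, satisfies the defining relations of the flag algebra of `K`: every `h s` is positive
(of the form `b* b`), `h s * h t = 0` whenever `{s, t}` is not a simplex of `K`, and the `h s`
sum up to `1`. (The vertex set being finite, the relations `∑ s, h s * h t = h t` say exactly that
`∑ s, h s` is the unit of the C*-algebra generated by the family.) -/
structure IsFlagFamily {V : Type} [Fintype V] [DecidableEq V] (K : AbstractSimplicialComplex V)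
    {B : Type*} [CStarAlgebra B] (h : V → B) : Prop where
  pos : ∀ s, ∃ b : B, h s = star b * b
  mul_eq_zero : ∀ s t, ({s, t} : Finset V) ∉ K.faces → h s * h t = 0
  sum_eq_one : ∑ s, h s = 1

namespace IsFlagFamily
variable {V : Type} [Fintype V] [DecidableEq V] {K : AbstractSimplicialComplex V}
    {B : Type*} [CStarAlgebra B] {h : V → B}

theorem isSelfAdjoint (hh : IsFlagFamily K h) (s : V) : IsSelfAdjoint (h s) := by
  obtain ⟨b, hb⟩ := hh.pos s
  rw [hb]; exact IsSelfAdjoint.star_mul_self b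

theorem norm_le (hh : IsFlagFamily K h) (s : V) : ‖h s‖ ≤ 1 := by
  nontriviality B
  let _ := CStarAlgebra.spectralOrder B
  have := CStarAlgebra.spectralOrderedRing B
  have hpos : ∀ t, 0 ≤ h t := fun t => by
    obtain ⟨b, hb⟩ := hh.pos t
    rw [hb]; exact star_mul_self_nonneg b
  have h1 : h s ≤ 1 := by
    rw [← hh.sum_eq_one]
    exact Finset.single_le_sum (fun t _ => hpos t) (Finset.mem_univ s)
  simpa using CStarAlgebra.norm_le_norm_of_nonneg_of_le (hpos s) h1

end IsFlagFamily

section FlagAlgebra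
variable {V : Type} [Fintype V] [DecidableEq V] (K : AbstractSimplicialComplex V)

/-- `p` is the C*-seminorm on the free algebra on the vertices of `K` that comes from some
representation of the defining relations of the flag algebra of `K` in a non-zero C*-algebra `B`.
It is no restriction that `B` lives in `Type`, since the C*-algebra generated by a finite family is
separable, hence has at most the cardinality of the continuum. -/
structure IsFlagSeminorm (p : FreeAlgebra ℂ V → ℝ) : Prop where
  out : ∃ (B : Type) (_ : CStarAlgebra B) (_ : Nontrivial B) (h : V → B),
    IsFlagFamily K h ∧ ∀ a, p a = ‖FreeAlgebra.lift ℂ h a‖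

/-- The set of all C*-seminorms coming from representations of the relations. -/
abbrev FlagSeminorm : Type := {p : FreeAlgebra ℂ V → ℝ // IsFlagSeminorm K p}

namespace FlagSeminorm
variable {K}

/-- A C*-algebra in which a representation with seminorm `p` lives. -/
def Alg (p : FlagSeminorm K) : Type := p.2.out.choose

noncomputable instance (p : FlagSeminorm K) : CStarAlgebra p.Alg := p.2.out.choose_spec.choose

instance (p : FlagSeminorm K) : Nontrivial p.Alg := p.2.out.choose_spec.choose_spec.choose

/-- A representation with seminorm `p`. -/
noncomputable def gen (p : FlagSeminorm K) : V → p.Alg :=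
  p.2.out.choose_spec.choose_spec.choose_spec.choose

theorem isFlagFamily_gen (p : FlagSeminorm K) : IsFlagFamily K p.gen :=
  p.2.out.choose_spec.choose_spec.choose_spec.choose_spec.1

theorem apply_eq_norm (p : FlagSeminorm K) (a : FreeAlgebra ℂ V) :
    p.1 a = ‖FreeAlgebra.lift ℂ p.gen a‖ :=
  p.2.out.choose_spec.choose_spec.choose_spec.choose_spec.2 a

end FlagSeminorm

/-- The C*-algebra of bounded families in the product of all representations (one for each
C*-seminorm). -/
abbrev FlagProd : Type := lp (fun p : FlagSeminorm K => p.Alg) ∞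

noncomputable instance : CStarAlgebra (FlagProd K) where

/-- The direct sum of all representations, on generators. -/
noncomputable def flagProdGen (s : V) : FlagProd K :=
  ⟨fun p => p.gen s, memℓp_infty ⟨1, by
    rintro _ ⟨p, rfl⟩; exact p.isFlagFamily_gen.norm_le s⟩⟩

/-- The C*-subalgebra generated by the direct sum of all representations. -/
noncomputable def flagSubalgebra : StarSubalgebra ℂ (FlagProd K) :=
  (StarAlgebra.adjoin ℂ (Set.range (flagProdGen K))).topologicalClosure

/-- The flag algebra of the finite simplicial complex `K`: the universal C*-algebra generated by positive
elements `h s`, for `s` a vertex of `K`, with `h s * h t = 0` if `{s, t}` is not a simplex of `K`,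
and `∑ s, h s = 1`. It is realized, as usual, as the C*-algebra generated by the direct sum of all
representations of the relations; see `FlagAlgebra.isFlagFamily_h`, `FlagAlgebra.lift`,
`FlagAlgebra.lift_h`, `FlagAlgebra.hom_ext` for the universal property. -/
def FlagAlgebra : Type := flagSubalgebra K

instance : IsClosed (flagSubalgebra K : Set (FlagProd K)) :=
  StarSubalgebra.isClosed_topologicalClosure _

noncomputable instance : CStarAlgebra (FlagAlgebra K) :=
  inferInstanceAs (CStarAlgebra (flagSubalgebra K))

/-- The canonical generators of the flag algebra. -/
noncomputable def FlagAlgebra.h (s : V) : FlagAlgebra K :=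
  ⟨flagProdGen K s, StarSubalgebra.le_topologicalClosure _
    (StarAlgebra.subset_adjoin ℂ _ ⟨s, rfl⟩)⟩

end FlagAlgebra

section Lift
variable {V : Type} [Fintype V] [DecidableEq V] {K : AbstractSimplicialComplex V}
variable {B : Type} [CStarAlgebra B] {b : V → B}

namespace FlagAlgebra

theorem coordinate_lift (p : FlagSeminorm K) (a : FreeAlgebra ℂ V) :
    (FreeAlgebra.lift ℂ (flagProdGen K) a : FlagProd K) p = FreeAlgebra.lift ℂ p.gen a := by
  let ev : FlagProd K →ₐ[ℂ] p.Alg :=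
    { toFun := fun f => f p
      map_one' := rfl
      map_zero' := rfl
      map_mul' := fun _ _ => rfl
      map_add' := fun _ _ => rfl
      commutes' := fun _ => rfl }
  have : ev.comp (FreeAlgebra.lift ℂ (flagProdGen K)) = FreeAlgebra.lift ℂ p.gen := by
    apply FreeAlgebra.hom_ext
    funext s
    simp only [Function.comp_apply, AlgHom.comp_apply, FreeAlgebra.lift_ι_apply]
    rfl
  exact DFunLike.congr_fun this a

/-- The inclusion of the flag algebra into the product of all representations. -/
noncomputable def val (K : AbstractSimplicialComplex V) : FlagAlgebra K →⋆ₐ[ℂ] FlagProd K :=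
  (flagSubalgebra K).subtype

theorem norm_val (x : FlagAlgebra K) : ‖val K x‖ = ‖x‖ := rfl

theorem val_injective : Function.Injective (val K) := Subtype.val_injective

theorem isInducing_val : Topology.IsInducing (val K) := Topology.IsInducing.subtypeVal

theorem val_h (s : V) : val K (h K s) = flagProdGen K s := rfl

theorem val_lift (a : FreeAlgebra ℂ V) :
    val K (FreeAlgebra.lift ℂ (h K) a) = FreeAlgebra.lift ℂ (flagProdGen K) a := by
  have : (val K).toAlgHom.comp (FreeAlgebra.lift ℂ (h K)) =
      FreeAlgebra.lift ℂ (flagProdGen K) := by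
    apply FreeAlgebra.hom_ext
    funext s
    simp [val_h]
  exact DFunLike.congr_fun this a

theorem norm_lift_le (hb : IsFlagFamily K b) (a : FreeAlgebra ℂ V) :
    ‖FreeAlgebra.lift ℂ b a‖ ≤ ‖FreeAlgebra.lift ℂ (h K) a‖ := by
  cases subsingleton_or_nontrivial B
  · rw [Subsingleton.elim (FreeAlgebra.lift ℂ b a) 0, norm_zero]; exact norm_nonneg _
  let p : FlagSeminorm K := ⟨fun a => ‖FreeAlgebra.lift ℂ b a‖, ⟨B, _, inferInstance, b, hb,
    fun _ => rfl⟩⟩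
  calc ‖FreeAlgebra.lift ℂ b a‖ = ‖FreeAlgebra.lift ℂ p.gen a‖ := p.apply_eq_norm a
    _ = ‖(FreeAlgebra.lift ℂ (flagProdGen K) a : FlagProd K) p‖ := by rw [coordinate_lift]
    _ ≤ ‖(FreeAlgebra.lift ℂ (flagProdGen K) a : FlagProd K)‖ :=
      lp.norm_apply_le_norm ENNReal.top_ne_zero _ p
    _ = _ := by rw [← val_lift, norm_val]

theorem star_flagProdGen (s : V) : star (flagProdGen K s) = flagProdGen K s := by
  apply lp.ext
  funext p
  exact (p.isFlagFamily_gen.isSelfAdjoint s)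

theorem star_h (s : V) : star (h K s) = h K s := 
  val_injective (star_flagProdGen s)

theorem denseRange_lift : DenseRange (FreeAlgebra.lift ℂ (h K)) := by
  intro x
  have hx : x.1 ∈ closure (Set.range (FreeAlgebra.lift ℂ (flagProdGen K))) := by
    have h1 : (StarAlgebra.adjoin ℂ (Set.range (flagProdGen K)) : Set (FlagProd K)) =
        Set.range (FreeAlgebra.lift ℂ (flagProdGen K)) := by
      have h2 : star (Set.range (flagProdGen K)) = Set.range (flagProdGen K) := by
        ext y
        constructor
        · rintro ⟨s, hs⟩
          exact ⟨s, by rw [← star_flagProdGen, hs, star_star]⟩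
        · rintro ⟨s, rfl⟩
          exact ⟨s, (star_flagProdGen s).symm⟩
      rw [← StarSubalgebra.coe_toSubalgebra, StarAlgebra.adjoin_toSubalgebra, h2, Set.union_self,
        Algebra.adjoin_range_eq_range_freeAlgebra_lift]
      rfl
    rw [← h1]
    exact x.2
  rw [isInducing_val.closure_eq_preimage_closure_image, ← Set.range_comp]
  have h3 : val K ∘ FreeAlgebra.lift ℂ (h K) = FreeAlgebra.lift ℂ (flagProdGen K) :=
    funext val_lift
  rw [h3]
  exact hx

/-- The map of `FlagAlgebra.lift`, as a continuous linear map. -/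
noncomputable def liftCLM (K : AbstractSimplicialComplex V) (b : V → B) : FlagAlgebra K →L[ℂ] B :=
  (FreeAlgebra.lift ℂ b).toLinearMap.extendOfNorm (FreeAlgebra.lift ℂ (h K)).toLinearMap

theorem liftCLM_lift (hb : IsFlagFamily K b) (a : FreeAlgebra ℂ V) :
    liftCLM K b (FreeAlgebra.lift ℂ (h K) a) = FreeAlgebra.lift ℂ b a :=
  LinearMap.extendOfNorm_eq (f := (FreeAlgebra.lift ℂ b).toLinearMap)
    (e := (FreeAlgebra.lift ℂ (h K)).toLinearMap) denseRange_lift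
    ⟨1, fun a => by simpa using norm_lift_le hb a⟩ a

theorem liftCLM_mul (hb : IsFlagFamily K b) (x y : FlagAlgebra K) :
    liftCLM K b (x * y) = liftCLM K b x * liftCLM K b y := by
  refine denseRange_lift.induction_on₂ (p := fun x y => liftCLM K b (x * y) = liftCLM K b x * liftCLM K b y)
    (isClosed_eq (by fun_prop) (by fun_prop)) (fun x y => ?_) x y
  rw [← map_mul, liftCLM_lift hb, liftCLM_lift hb, liftCLM_lift hb, map_mul]

theorem liftCLM_star (hb : IsFlagFamily K b) (x : FlagAlgebra K) :
    liftCLM K b (star x) = star (liftCLM K b x) := by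
  refine denseRange_lift.induction_on (p := fun x => liftCLM K b (star x) = star (liftCLM K b x)) x
    (isClosed_eq (by fun_prop) (by fun_prop)) fun a => ?_
  rw [liftCLM_lift hb]
  induction a using FreeAlgebra.induction with
  | grade0 r =>
    have := liftCLM_lift hb (algebraMap ℂ _ (star r))
    rw [AlgHom.commutes, AlgHom.commutes] at this
    rw [AlgHom.commutes, AlgHom.commutes, ← algebraMap_star_comm, this, algebraMap_star_comm]
  | grade1 s =>
    have := liftCLM_lift hb (FreeAlgebra.ι ℂ s)
    rw [FreeAlgebra.lift_ι_apply, FreeAlgebra.lift_ι_apply] at this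
    rw [FreeAlgebra.lift_ι_apply, FreeAlgebra.lift_ι_apply, star_h, this, hb.isSelfAdjoint s]
  | mul x y hx hy => rw [map_mul, map_mul, star_mul, liftCLM_mul hb, hx, hy, star_mul]
  | add x y hx hy => rw [map_add, map_add, star_add, map_add, hx, hy, star_add]

/-- Universal property: a family in a C*-algebra `B` that satisfies the defining relations of the flag
algebra induces a unital *-homomorphism from the flag algebra to `B`. -/
noncomputable def lift (b : V → B) (hb : IsFlagFamily K b) : FlagAlgebra K →⋆ₐ[ℂ] B where
  toFun := liftCLM K b
  map_one' := by simpa using liftCLM_lift hb 1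
  map_zero' := map_zero _
  map_add' := map_add _
  map_mul' := liftCLM_mul hb
  commutes' r := by simpa using liftCLM_lift hb (algebraMap ℂ _ r)
  map_star' := liftCLM_star hb

theorem lift_h (hb : IsFlagFamily K b) (s : V) : lift b hb (h K s) = b s := by
  have := liftCLM_lift hb (FreeAlgebra.ι ℂ s)
  rwa [FreeAlgebra.lift_ι_apply, FreeAlgebra.lift_ι_apply] at this

theorem hom_ext {f g : FlagAlgebra K →⋆ₐ[ℂ] B} (hfg : ∀ s, f (h K s) = g (h K s)) : f = g := by
  have hf : Continuous f :=
    AddMonoidHomClass.continuous_of_bound f 1 fun a => by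
      simpa using NonUnitalStarAlgHom.norm_apply_le f a
  have hg : Continuous g :=
    AddMonoidHomClass.continuous_of_bound g 1 fun a => by
      simpa using NonUnitalStarAlgHom.norm_apply_le g a
  have h1 : f.toAlgHom.comp (FreeAlgebra.lift ℂ (h K)) =
      g.toAlgHom.comp (FreeAlgebra.lift ℂ (h K)) := by
    apply FreeAlgebra.hom_ext
    funext s
    simpa using hfg s
  apply DFunLike.ext
  intro x
  exact denseRange_lift.induction_on (p := fun x => f x = g x) x (isClosed_eq hf hg)
    fun a => DFunLike.congr_fun h1 a

theorem spectrum_star_mul_self_nonneg {A : Type*} [CStarAlgebra A] (c : A) {x : ℝ}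
    (hx : x ∈ spectrum ℝ (star c * c)) : 0 ≤ x := by
  let _ := CStarAlgebra.spectralOrder A
  have := CStarAlgebra.spectralOrderedRing A
  exact spectrum_nonneg_of_nonneg (star_mul_self_nonneg c) hx

theorem isFlagFamily_h : IsFlagFamily K (h K) where
  pos s := by
    choose b hb using fun p : FlagSeminorm K => p.isFlagFamily_gen.pos s
    have hbound : ∀ p, ‖b p‖ ≤ 1 := fun p => by
      have h1 := p.isFlagFamily_gen.norm_le s
      rw [hb, CStarRing.norm_star_mul_self] at h1
      nlinarith [norm_nonneg (b p)]
    let c : FlagProd K := ⟨b, memℓp_infty ⟨1, by rintro _ ⟨p, rfl⟩; exact hbound p⟩⟩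
    have hc : flagProdGen K s = star c * c := by
      apply lp.ext
      funext p
      exact hb p
    let _ := CStarAlgebra.spectralOrder (FlagAlgebra K)
    have := CStarAlgebra.spectralOrderedRing (FlagAlgebra K)
    rw [← CStarAlgebra.nonneg_iff_eq_star_mul_self,
      StarOrderedRing.nonneg_iff_spectrum_nonneg (R := ℝ) (h K s)
        (show IsSelfAdjoint (h K s) from star_h s)]
    intro x hx
    rw [← spectrum.algebraMap_mem_iff ℂ] at hx
    have hx' := ((flagSubalgebra K).mem_spectrum_iff (a := h K s)).1 hx
    rw [spectrum.algebraMap_mem_iff ℂ] at hx'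
    change x ∈ spectrum ℝ (flagProdGen K s) at hx'
    rw [hc] at hx'
    exact spectrum_star_mul_self_nonneg c hx'
  mul_eq_zero s t hst := by
    apply val_injective
    apply lp.ext
    funext p
    exact p.isFlagFamily_gen.mul_eq_zero s t hst
  sum_eq_one := by
    have h1 : (FreeAlgebra.lift ℂ (h K) (∑ s, FreeAlgebra.ι ℂ s)) = 1 := by
      apply val_injective
      rw [val_lift]
      apply lp.ext
      funext p
      rw [coordinate_lift, map_sum]
      simp only [FreeAlgebra.lift_ι_apply]
      exact p.isFlagFamily_gen.sum_eq_one
    simpa using h1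

end FlagAlgebra
end Lift

end Universal

section KTheory
open scoped Matrix

section KZero
variable {A : Type*} [CStarAlgebra A] {B : Type*} [CStarAlgebra B]

/-- Murray-von Neumann equivalence of projections in (possibly different) matrix algebras over `A`. -/
def MvNEquiv {m n : Type*} [Fintype m] [Fintype n] (p : Matrix m m A) (q : Matrix n n A) : Prop :=
  ∃ v : Matrix m n A, v * vᴴ = p ∧ vᴴ * v = q

namespace MvNEquiv
variable {m n l m' n' : Type*} [Fintype m] [Fintype n] [Fintype l] [Fintype m'] [Fintype n']

theorem refl {p : Matrix m m A} (hp : IsStarProjection p) : MvNEquiv p p :=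
  ⟨p, by rw [← Matrix.star_eq_conjTranspose, hp.isSelfAdjoint.star_eq, hp.isIdempotentElem.eq],
    by rw [← Matrix.star_eq_conjTranspose, hp.isSelfAdjoint.star_eq, hp.isIdempotentElem.eq]⟩

theorem symm {p : Matrix m m A} {q : Matrix n n A} (h : MvNEquiv p q) : MvNEquiv q p := by
  obtain ⟨v, h1, h2⟩ := h
  exact ⟨vᴴ, by rwa [Matrix.conjTranspose_conjTranspose],
    by rwa [Matrix.conjTranspose_conjTranspose]⟩

theorem trans {p : Matrix m m A} {q : Matrix n n A} {r : Matrix l l A} (hp : IsStarProjection p)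
    (hr : IsStarProjection r) (h : MvNEquiv p q) (h' : MvNEquiv q r) : MvNEquiv p r := by
  obtain ⟨v, h1, h2⟩ := h
  obtain ⟨w, h3, h4⟩ := h'
  refine ⟨v * w, ?_, ?_⟩
  · calc v * w * (v * w)ᴴ = v * (w * wᴴ) * vᴴ := by
          rw [Matrix.conjTranspose_mul]; simp only [Matrix.mul_assoc]
      _ = (v * vᴴ) * (v * vᴴ) := by rw [h3, ← h2]; simp only [Matrix.mul_assoc]
      _ = p := by rw [h1, hp.isIdempotentElem.eq]
  · calc (v * w)ᴴ * (v * w) = wᴴ * (vᴴ * v) * w := by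
          rw [Matrix.conjTranspose_mul]; simp only [Matrix.mul_assoc]
      _ = (wᴴ * w) * (wᴴ * w) := by rw [h2, ← h3]; simp only [Matrix.mul_assoc]
      _ = r := by rw [h4, hr.isIdempotentElem.eq]

theorem reindex {p : Matrix m m A} (hp : IsStarProjection p) (e : m ≃ n) :
    MvNEquiv p (Matrix.reindex e e p) := by
  have h1 : p * pᴴ = p := by
    rw [← Matrix.star_eq_conjTranspose, hp.isSelfAdjoint.star_eq, hp.isIdempotentElem.eq]
  have h2 : pᴴ * p = p := by
    rw [← Matrix.star_eq_conjTranspose, hp.isSelfAdjoint.star_eq, hp.isIdempotentElem.eq]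
  refine ⟨p.submatrix id e.symm, ?_, ?_⟩
  · rw [Matrix.conjTranspose_submatrix, Matrix.submatrix_mul_equiv, h1, Matrix.submatrix_id_id]
  · have h3 := Matrix.submatrix_mul_equiv pᴴ p e.symm (Equiv.refl m) e.symm
    rw [h2] at h3
    exact h3

theorem fromBlocks {p : Matrix m m A} {q : Matrix n n A} {p' : Matrix m' m' A}
    {q' : Matrix n' n' A} (h : MvNEquiv p p') (h' : MvNEquiv q q') :
    MvNEquiv (Matrix.fromBlocks p 0 0 q) (Matrix.fromBlocks p' 0 0 q') := by
  obtain ⟨v, h1, h2⟩ := h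
  obtain ⟨w, h3, h4⟩ := h'
  refine ⟨Matrix.fromBlocks v 0 0 w, ?_, ?_⟩ <;>
  simp [Matrix.fromBlocks_conjTranspose, Matrix.fromBlocks_multiply, h1, h2, h3, h4]

theorem map {p : Matrix m m A} {q : Matrix n n A} (φ : A →⋆ₐ[ℂ] B) (h : MvNEquiv p q) :
    MvNEquiv (p.map φ) (q.map φ) := by
  obtain ⟨v, h1, h2⟩ := h
  refine ⟨v.map φ, ?_, ?_⟩
  · rw [← h1, Matrix.map_mul, Matrix.conjTranspose_map φ fun a => map_star φ a]
  · rw [← h2, Matrix.map_mul, Matrix.conjTranspose_map φ fun a => map_star φ a]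

end MvNEquiv

theorem _root_.IsStarProjection.matrix_reindex {m n : Type*} [Fintype m] [Fintype n]
    {p : Matrix m m A} (hp : IsStarProjection p) (e : m ≃ n) :
    IsStarProjection (Matrix.reindex e e p) where
  isIdempotentElem := by
    rw [IsIdempotentElem, Matrix.reindex_apply, Matrix.submatrix_mul_equiv,
      hp.isIdempotentElem.eq]
  isSelfAdjoint := by
    rw [IsSelfAdjoint, Matrix.star_eq_conjTranspose, Matrix.conjTranspose_reindex,
      ← Matrix.star_eq_conjTranspose, hp.isSelfAdjoint.star_eq]

theorem _root_.IsStarProjection.matrix_fromBlocks {m n : Type*} [Fintype m] [Fintype n]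
    {p : Matrix m m A} {q : Matrix n n A} (hp : IsStarProjection p) (hq : IsStarProjection q) :
    IsStarProjection (Matrix.fromBlocks p 0 0 q) where
  isIdempotentElem := by
    simp [IsIdempotentElem, Matrix.fromBlocks_multiply, hp.isIdempotentElem.eq,
      hq.isIdempotentElem.eq]
  isSelfAdjoint := by
    rw [IsSelfAdjoint, Matrix.star_eq_conjTranspose, Matrix.fromBlocks_conjTranspose,
      ← Matrix.star_eq_conjTranspose, ← Matrix.star_eq_conjTranspose, hp.isSelfAdjoint.star_eq,
      hq.isSelfAdjoint.star_eq]
    simp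

theorem _root_.IsStarProjection.matrix_map {m : Type*} [Fintype m] {p : Matrix m m A}
    (hp : IsStarProjection p) (φ : A →⋆ₐ[ℂ] B) : IsStarProjection (p.map φ) where
  isIdempotentElem := by
    rw [IsIdempotentElem, ← Matrix.map_mul, hp.isIdempotentElem.eq]
  isSelfAdjoint := by
    rw [IsSelfAdjoint, Matrix.star_eq_conjTranspose,
      ← Matrix.conjTranspose_map φ fun a => map_star φ a, ← Matrix.star_eq_conjTranspose,
      hp.isSelfAdjoint.star_eq]

/-- A projection in some matrix algebra `M_n(A)`. -/
structure MatrixProjection (A : Type*) [CStarAlgebra A] where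
  size : ℕ
  mat : Matrix (Fin size) (Fin size) A
  isStarProjection : IsStarProjection mat

namespace MatrixProjection

/-- Murray-von Neumann equivalence as a setoid. -/
instance setoid : Setoid (MatrixProjection A) where
  r p q := MvNEquiv p.mat q.mat
  iseqv :=
    ⟨fun p => MvNEquiv.refl p.isStarProjection, fun h => h.symm,
      fun {p _ r} h h' => h.trans p.isStarProjection r.isStarProjection h'⟩

/-- The block diagonal sum `diag(p, q)`. -/
def sum (p q : MatrixProjection A) : MatrixProjection A where
  size := p.size + q.size
  mat := Matrix.reindex finSumFinEquiv finSumFinEquiv (Matrix.fromBlocks p.mat 0 0 q.mat)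
  isStarProjection :=
    (p.isStarProjection.matrix_fromBlocks q.isStarProjection).matrix_reindex finSumFinEquiv

theorem sum_equiv (p q : MatrixProjection A) :
    MvNEquiv (Matrix.fromBlocks p.mat 0 0 q.mat) (p.sum q).mat :=
  MvNEquiv.reindex (p.isStarProjection.matrix_fromBlocks q.isStarProjection) finSumFinEquiv

/-- The zero projection (of size `0`). -/
def zero : MatrixProjection A where
  size := 0
  mat := 0
  isStarProjection := .zero _

/-- The image of a projection under a *-homomorphism, applied entrywise. -/
def map (φ : A →⋆ₐ[ℂ] B) (p : MatrixProjection A) : MatrixProjection B where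
  size := p.size
  mat := p.mat.map φ
  isStarProjection := p.isStarProjection.matrix_map φ

theorem sum_congr {p p' q q' : MatrixProjection A} (h : p ≈ p') (h' : q ≈ q') :
    p.sum q ≈ p'.sum q' :=
  (sum_equiv p q).symm.trans (p.sum q).isStarProjection (p'.sum q').isStarProjection <|
    (MvNEquiv.fromBlocks h h').trans (p.isStarProjection.matrix_fromBlocks q.isStarProjection)
      (p'.sum q').isStarProjection (sum_equiv p' q')

theorem sum_comm (p q : MatrixProjection A) : p.sum q ≈ q.sum p := by
  refine (sum_equiv p q).symm.trans (p.sum q).isStarProjection (q.sum p).isStarProjection ?_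
  have hpq := p.isStarProjection.matrix_fromBlocks q.isStarProjection
  have h := MvNEquiv.reindex hpq (Equiv.sumComm _ _)
  have h2 : Matrix.reindex (Equiv.sumComm _ _) (Equiv.sumComm _ _)
      (Matrix.fromBlocks p.mat 0 0 q.mat) = Matrix.fromBlocks q.mat 0 0 p.mat := by
    ext (i | i) (j | j) <;> rfl
  rw [h2] at h
  exact h.trans hpq (q.sum p).isStarProjection (sum_equiv q p)

theorem sum_assoc (p q r : MatrixProjection A) : (p.sum q).sum r ≈ p.sum (q.sum r) := by
  have hp := p.isStarProjection
  have hq := q.isStarProjection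
  have hr := r.isStarProjection
  have h1 := hp.matrix_fromBlocks (hq.matrix_fromBlocks hr)
  have h2 := (hp.matrix_fromBlocks hq).matrix_fromBlocks hr
  have h := MvNEquiv.reindex h2 (Equiv.sumAssoc _ _ _)
  have h3 : Matrix.reindex (Equiv.sumAssoc _ _ _) (Equiv.sumAssoc _ _ _)
      (Matrix.fromBlocks (Matrix.fromBlocks p.mat 0 0 q.mat) 0 0 r.mat) =
      Matrix.fromBlocks p.mat 0 0 (Matrix.fromBlocks q.mat 0 0 r.mat) := by
    ext (i | i | i) (j | j | j) <;> rfl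
  rw [h3] at h
  have h4 : MvNEquiv ((p.sum q).sum r).mat
      (Matrix.fromBlocks (Matrix.fromBlocks p.mat 0 0 q.mat) 0 0 r.mat) :=
    (sum_equiv (p.sum q) r).symm.trans ((p.sum q).sum r).isStarProjection h2
      (MvNEquiv.fromBlocks (sum_equiv p q).symm (MvNEquiv.refl hr))
  have h5 : MvNEquiv (Matrix.fromBlocks p.mat 0 0 (Matrix.fromBlocks q.mat 0 0 r.mat))
      (p.sum (q.sum r)).mat :=
    (MvNEquiv.fromBlocks (MvNEquiv.refl hp) (sum_equiv q r)).trans h1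
      (p.sum (q.sum r)).isStarProjection (sum_equiv p (q.sum r))
  exact (h4.trans ((p.sum q).sum r).isStarProjection h1 h).trans
    ((p.sum q).sum r).isStarProjection (p.sum (q.sum r)).isStarProjection h5

theorem zero_sum (p : MatrixProjection A) : zero.sum p ≈ p := by
  refine (sum_equiv zero p).symm.trans (zero.sum p).isStarProjection p.isStarProjection ?_
  have h0 := (zero (A := A)).isStarProjection.matrix_fromBlocks p.isStarProjection
  have h := MvNEquiv.reindex p.isStarProjection (Equiv.emptySum (Fin 0) (Fin p.size)).symm
  have h2 : Matrix.reindex (Equiv.emptySum (Fin 0) (Fin p.size)).symm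
      (Equiv.emptySum (Fin 0) (Fin p.size)).symm p.mat =
      Matrix.fromBlocks (zero (A := A)).mat 0 0 p.mat := by
    ext (i | i) (j | j)
    · exact i.elim0
    · exact i.elim0
    · exact j.elim0
    · rfl
  rw [h2] at h
  exact h.symm

theorem map_reindex_fromBlocks {m n l : Type*} (φ : A →⋆ₐ[ℂ] B) (e : m ⊕ n ≃ l)
    (p : Matrix m m A) (q : Matrix n n A) :
    (Matrix.reindex e e (Matrix.fromBlocks p 0 0 q)).map φ =
      Matrix.reindex e e (Matrix.fromBlocks (p.map φ) 0 0 (q.map φ)) := by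
  rw [Matrix.reindex_apply, Matrix.reindex_apply, ← Matrix.submatrix_map, Matrix.fromBlocks_map,
    Matrix.map_zero _ (map_zero φ), Matrix.map_zero _ (map_zero φ)]

theorem map_sum (φ : A →⋆ₐ[ℂ] B) (p q : MatrixProjection A) :
    (p.sum q).map φ = (p.map φ).sum (q.map φ) := by
  have : ∀ (n : ℕ) (a b : Matrix (Fin n) (Fin n) B) (ha : IsStarProjection a)
      (hb : IsStarProjection b), a = b → (⟨n, a, ha⟩ : MatrixProjection B) = ⟨n, b, hb⟩ := by
    rintro n a _ ha hb rfl
    rfl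
  exact this _ _ _ _ _ (map_reindex_fromBlocks φ finSumFinEquiv p.mat q.mat)

end MatrixProjection

/-- The monoid of Murray-von Neumann classes of projections in matrix algebras over `A`, with block
diagonal sum as addition. -/
def ProjClass (A : Type*) [CStarAlgebra A] : Type _ := Quotient (MatrixProjection.setoid (A := A))

namespace ProjClass

instance : Zero (ProjClass A) := ⟨Quotient.mk _ MatrixProjection.zero⟩

instance : Add (ProjClass A) :=
  ⟨Quotient.map₂ MatrixProjection.sum fun _ _ h _ _ h' => MatrixProjection.sum_congr h h'⟩

instance : AddCommMonoid (ProjClass A) where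
  add_assoc := by
    rintro ⟨p⟩ ⟨q⟩ ⟨r⟩; exact Quotient.sound (MatrixProjection.sum_assoc p q r)
  add_comm := by
    rintro ⟨p⟩ ⟨q⟩; exact Quotient.sound (MatrixProjection.sum_comm p q)
  zero_add := by
    rintro ⟨p⟩; exact Quotient.sound (MatrixProjection.zero_sum p)
  add_zero := by
    rintro ⟨p⟩
    exact Quotient.sound (Setoid.trans (MatrixProjection.sum_comm p .zero)
      (MatrixProjection.zero_sum p))
  nsmul := nsmulRec

/-- The map induced by a *-homomorphism on classes of projections. -/
def map (φ : A →⋆ₐ[ℂ] B) : ProjClass A →+ ProjClass B where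
  toFun := Quotient.map (MatrixProjection.map φ) fun _ _ h => MvNEquiv.map φ h
  map_zero' := Quotient.sound <| show MvNEquiv _ _ by
    have : (MatrixProjection.map φ .zero).mat = (MatrixProjection.zero (A := B)).mat := by
      ext i
      exact i.elim0
    rw [this]
    exact MvNEquiv.refl (MatrixProjection.zero (A := B)).isStarProjection
  map_add' := by
    rintro ⟨p⟩ ⟨q⟩
    exact congrArg (Quotient.mk _) (MatrixProjection.map_sum φ p q)

end ProjClass

/-- `K₀(A)` of a unital C*-algebra `A`: the Grothendieck group of the monoid of Murray-von Neumann
classes of projections in matrix algebras over `A`. -/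
abbrev KZero (A : Type*) [CStarAlgebra A] : Type _ := Algebra.GrothendieckAddGroup (ProjClass A)

/-- The homomorphism `K₀(φ)` induced by a unital *-homomorphism `φ`. -/
noncomputable def KZero.map (φ : A →⋆ₐ[ℂ] B) : KZero A →+ KZero B :=
  Algebra.GrothendieckAddGroup.lift (Algebra.GrothendieckAddGroup.of.comp (ProjClass.map φ))

end KZero

section KOne

/-- The group `π₀(G) = G / G₀` of path components of a topological group. -/
def PiZero (G : Type*) [Group G] [TopologicalSpace G] [IsTopologicalGroup G] : Type _ :=
  G ⧸ Subgroup.pathComponentOne G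

namespace PiZero
variable {G H L : Type*} [Group G] [TopologicalSpace G] [IsTopologicalGroup G]
  [Group H] [TopologicalSpace H] [IsTopologicalGroup H]
  [Group L] [TopologicalSpace L] [IsTopologicalGroup L]

instance : Group (PiZero G) := inferInstanceAs (Group (G ⧸ Subgroup.pathComponentOne G))

/-- The class of an element in `π₀(G)`. -/
def mk : G →* PiZero G := QuotientGroup.mk' (Subgroup.pathComponentOne G)

/-- The map induced on `π₀` by a continuous homomorphism. -/
def map (f : G →* H) (hf : Continuous f) : PiZero G →* PiZero H :=
  QuotientGroup.map _ _ f fun g (hg : Joined 1 g) => by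
    have h : Joined (f 1) (f g) := hg.map hf
    rwa [map_one] at h

theorem map_mk (f : G →* H) (hf : Continuous f) (g : G) : map f hf (mk g) = mk (f g) := rfl

theorem mk_surjective : Function.Surjective (mk : G →* PiZero G) := QuotientGroup.mk'_surjective _

end PiZero

section
variable {A : Type*} [CStarAlgebra A] {B : Type*} [CStarAlgebra B]

/-- The unitary group `U_n(A)` (the entrywise topology on `M_n(A)` is its norm topology). -/
abbrev UnitaryMatrix (A : Type*) [CStarAlgebra A] (n : ℕ) : Type _ := unitary (Matrix (Fin n) (Fin n) A)

/-- The embedding `u ↦ diag(u, 1)` of `M_m(A)` into `M_n(A)`, for `m ≤ n`. -/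
def stabilizeMatrix {m n : ℕ} (h : m ≤ n) (u : Matrix (Fin m) (Fin m) A) :
    Matrix (Fin n) (Fin n) A :=
  Matrix.reindex (finSumFinEquiv.trans (finCongr (Nat.add_sub_of_le h)))
    (finSumFinEquiv.trans (finCongr (Nat.add_sub_of_le h))) (Matrix.fromBlocks u 0 0 1)

theorem stabilizeMatrix_apply {m n : ℕ} (h : m ≤ n) (u : Matrix (Fin m) (Fin m) A) (i j : Fin n) :
    stabilizeMatrix h u i j =
      if hij : i.1 < m ∧ j.1 < m then u ⟨i, hij.1⟩ ⟨j, hij.2⟩ else if i = j then 1 else 0 := by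
  obtain ⟨k, rfl⟩ := Nat.exists_eq_add_of_le h
  obtain ⟨i, rfl⟩ := (finSumFinEquiv.trans (finCongr (Nat.add_sub_of_le h))).surjective i
  obtain ⟨j, rfl⟩ := (finSumFinEquiv.trans (finCongr (Nat.add_sub_of_le h))).surjective j
  rw [stabilizeMatrix, Matrix.reindex_apply, Matrix.submatrix_apply, Equiv.symm_apply_apply,
    Equiv.symm_apply_apply]
  rcases i with i | i <;> rcases j with j | j <;>
    simp [Fin.ext_iff, Matrix.one_apply] <;> omega

theorem stabilizeMatrix_mul {m n : ℕ} (h : m ≤ n) (u v : Matrix (Fin m) (Fin m) A) :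
    stabilizeMatrix h (u * v) = stabilizeMatrix h u * stabilizeMatrix h v := by
  simp only [stabilizeMatrix, Matrix.reindex_apply]
  rw [Matrix.submatrix_mul_equiv, Matrix.fromBlocks_multiply]
  simp

theorem stabilizeMatrix_one {m n : ℕ} (h : m ≤ n) :
    stabilizeMatrix h (1 : Matrix (Fin m) (Fin m) A) = 1 := by
  rw [stabilizeMatrix, Matrix.fromBlocks_one, Matrix.reindex_apply, Matrix.submatrix_one_equiv]

theorem stabilizeMatrix_star {m n : ℕ} (h : m ≤ n) (u : Matrix (Fin m) (Fin m) A) :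
    stabilizeMatrix h (star u) = star (stabilizeMatrix h u) := by
  rw [stabilizeMatrix, stabilizeMatrix, Matrix.star_eq_conjTranspose,
    Matrix.star_eq_conjTranspose, Matrix.conjTranspose_reindex, Matrix.fromBlocks_conjTranspose]
  simp

/-- The embedding `u ↦ diag(u, 1)` of `U_m(A)` into `U_n(A)`, for `m ≤ n`. -/
def stabilizeUnitary (A : Type*) [CStarAlgebra A] {m n : ℕ} (h : m ≤ n) :
    UnitaryMatrix A m →* UnitaryMatrix A n :=
  (Unitary.map (⟨⟨⟨stabilizeMatrix h, stabilizeMatrix_one h⟩, stabilizeMatrix_mul h⟩,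
    stabilizeMatrix_star h⟩ : Matrix (Fin m) (Fin m) A →⋆* Matrix (Fin n) (Fin n) A)).toMonoidHom

theorem coe_stabilizeUnitary {m n : ℕ} (h : m ≤ n) (u : UnitaryMatrix A m) :
    (stabilizeUnitary A h u : Matrix (Fin n) (Fin n) A) = stabilizeMatrix h u := rfl

theorem continuous_stabilizeUnitary {m n : ℕ} (h : m ≤ n) :
    Continuous (stabilizeUnitary A h) := by
  refine Continuous.subtype_mk ?_ _
  change Continuous fun u : UnitaryMatrix A m => stabilizeMatrix h u.1
  unfold stabilizeMatrix
  simp only [Matrix.reindex_apply]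
  fun_prop

/-- The map `U_n(A) → U_n(B)` induced by a unital *-homomorphism, applied entrywise. -/
def mapUnitary (φ : A →⋆ₐ[ℂ] B) (n : ℕ) : UnitaryMatrix A n →* UnitaryMatrix B n :=
  (Unitary.map (⟨⟨⟨fun u => u.map φ, Matrix.map_one _ (map_zero φ) (map_one φ)⟩,
    fun _ _ => Matrix.map_mul⟩, fun _ => Matrix.conjTranspose_map φ fun a => map_star φ a⟩ :
      Matrix (Fin n) (Fin n) A →⋆* Matrix (Fin n) (Fin n) B)).toMonoidHom

theorem coe_mapUnitary (φ : A →⋆ₐ[ℂ] B) (n : ℕ) (u : UnitaryMatrix A n) :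
    (mapUnitary φ n u : Matrix (Fin n) (Fin n) B) = (u : Matrix (Fin n) (Fin n) A).map φ := rfl

theorem continuous_starAlgHom (φ : A →⋆ₐ[ℂ] B) : Continuous φ :=
  AddMonoidHomClass.continuous_of_bound φ 1 fun a => by
    simpa using NonUnitalStarAlgHom.norm_apply_le φ a

theorem continuous_mapUnitary (φ : A →⋆ₐ[ℂ] B) (n : ℕ) : Continuous (mapUnitary φ n) := by
  refine Continuous.subtype_mk ?_ _
  have := continuous_starAlgHom φ
  change Continuous fun u : UnitaryMatrix A n => u.1.map φ
  fun_prop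

theorem stabilizeUnitary_mapUnitary (φ : A →⋆ₐ[ℂ] B) {m n : ℕ} (h : m ≤ n)
    (u : UnitaryMatrix A m) :
    stabilizeUnitary B h (mapUnitary φ m u) = mapUnitary φ n (stabilizeUnitary A h u) := by
  apply Subtype.ext
  ext i j
  rw [coe_stabilizeUnitary, coe_mapUnitary, coe_mapUnitary, Matrix.map_apply,
    coe_stabilizeUnitary, stabilizeMatrix_apply, stabilizeMatrix_apply]
  split_ifs <;> simp

/-- The map `π₀(U_m(A)) → π₀(U_n(A))` induced by `u ↦ diag(u, 1)`. -/
def piZeroStabilize (A : Type*) [CStarAlgebra A] (m n : ℕ) (h : m ≤ n) :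
    PiZero (UnitaryMatrix A m) →* PiZero (UnitaryMatrix A n) :=
  PiZero.map (stabilizeUnitary A h) (continuous_stabilizeUnitary h)

instance : DirectedSystem (fun n => PiZero (UnitaryMatrix A n)) (piZeroStabilize A · · ·) where
  map_self := by
    intro n x
    obtain ⟨u, rfl⟩ := PiZero.mk_surjective x
    rw [piZeroStabilize, PiZero.map_mk]
    congr 1
    apply Subtype.ext
    ext i j
    rw [coe_stabilizeUnitary, stabilizeMatrix_apply, dif_pos ⟨i.2, j.2⟩]
  map_map := by
    intro k j i hij hjk x
    obtain ⟨u, rfl⟩ := PiZero.mk_surjective x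
    simp only [piZeroStabilize, PiZero.map_mk]
    congr 1
    apply Subtype.ext
    ext a b
    simp only [coe_stabilizeUnitary, stabilizeMatrix_apply, Fin.ext_iff]
    split_ifs <;> first | rfl | omega

/-- `K₁(A)` of a unital C*-algebra `A`: the direct limit of the groups `π₀(U_n(A))` of path components
of unitary matrices along `u ↦ diag(u, 1)`. It is written multiplicatively. -/
abbrev KOne (A : Type*) [CStarAlgebra A] : Type _ :=
  DirectLimit (fun n => PiZero (UnitaryMatrix A n)) (piZeroStabilize A)

/-- The homomorphism `K₁(φ)` induced by a unital *-homomorphism `φ`. -/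
noncomputable def KOne.map (φ : A →⋆ₐ[ℂ] B) : KOne A →* KOne B where
  toFun := DirectLimit.map _ _
    (fun n => PiZero.map (mapUnitary φ n) (continuous_mapUnitary φ n)) (by
      intro m n h x
      obtain ⟨u, rfl⟩ := PiZero.mk_surjective x
      simp only [piZeroStabilize, PiZero.map_mk, stabilizeUnitary_mapUnitary])
  map_one' := by
    rw [DirectLimit.one_def 0, DirectLimit.one_def 0, DirectLimit.map_def, map_one]
  map_mul' := by
    refine DirectLimit.induction₂ _ fun n x y => ?_
    rw [DirectLimit.mul_def]
    simp only [DirectLimit.map_def]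
    rw [DirectLimit.mul_def, map_mul]
end
end KOne

end KTheory

section NoncommutativeSphere

namespace FlagAlgebra
variable {V : Type} [Fintype V] [DecidableEq V]

theorem isFlagFamily_single (K : AbstractSimplicialComplex V) (s : V) :
    IsFlagFamily K (Pi.single s (1 : ℂ)) where
  pos t := by
    by_cases hts : t = s
    · subst hts
      exact ⟨1, by simp⟩
    · exact ⟨0, by simp [hts]⟩
  mul_eq_zero t u htu := by
    by_cases ht : t = s
    · by_cases hu : u = s
      · subst ht hu
        rw [Finset.pair_eq_singleton] at htu
        exact absurd (K.singleton_mem u) htu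
      · simp [hu]
    · simp [ht]
  sum_eq_one := by simp

/-- The evaluation map at the vertex `s`: it maps the generator `h s` to `1` and all the other
generators to `0`. -/
noncomputable def eval (K : AbstractSimplicialComplex V) (s : V) : FlagAlgebra K →⋆ₐ[ℂ] ℂ :=
  lift (Pi.single s 1) (isFlagFamily_single K s)

theorem eval_h (K : AbstractSimplicialComplex V) (s t : V) :
    eval K s (h K t) = if t = s then 1 else 0 := by
  rw [eval, lift_h, Pi.single_apply]

end FlagAlgebra

/-- The octahedral simplicial model of the `n`-sphere, with vertices `i⁺ = (i, true)` and
`i⁻ = (i, false)`, `0 ≤ i ≤ n`: the simplexes are the non-empty sets of vertices that do not contain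
both `i⁺` and `i⁻` for any `i`. -/
def octahedralSphere (n : ℕ) : AbstractSimplicialComplex (Fin (n + 1) × Bool) where
  faces := {F | F.Nonempty ∧ ∀ i, ¬ ((i, true) ∈ F ∧ (i, false) ∈ F)}
  isRelLowerSet_faces := fun _ hF =>
    ⟨hF.1, fun _ hGF hG => ⟨hG, fun i hi => hF.2 i ⟨hGF hi.1, hGF hi.2⟩⟩⟩
  singleton_mem := by
    rintro ⟨j, b⟩
    refine ⟨Finset.singleton_nonempty _, fun i hi => ?_⟩
    simp only [Finset.mem_singleton, Prod.mk.injEq] at hi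
    exact absurd (hi.1.2.trans hi.2.2.symm) (by simp)

/-- Exactly the edges `{i⁺, i⁻}` do not belong to the octahedral sphere. -/
theorem pair_mem_octahedralSphere_iff (n : ℕ) (s t : Fin (n + 1) × Bool) :
    ({s, t} : Finset _) ∈ (octahedralSphere n).faces ↔ ¬ (s.1 = t.1 ∧ s.2 ≠ t.2) := by
  obtain ⟨i, a⟩ := s
  obtain ⟨j, b⟩ := t
  simp only [octahedralSphere, Set.mem_ofPred_eq, Finset.insert_nonempty, true_and,
    Finset.mem_insert, Finset.mem_singleton, Prod.mk.injEq]
  cases a <;> cases b <;> simp <;> grind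

/-- The octahedral sphere is a full (flag) complex: a non-empty set of vertices is a simplex as soon
as all its pairs are. -/
theorem octahedralSphere_isFull (n : ℕ) (F : Finset (Fin (n + 1) × Bool)) (hF : F.Nonempty)
    (h : ∀ s ∈ F, ∀ t ∈ F, ({s, t} : Finset _) ∈ (octahedralSphere n).faces) :
    F ∈ (octahedralSphere n).faces :=
  ⟨hF, fun i hi => (pair_mem_octahedralSphere_iff n _ _).1 (h _ hi.1 _ hi.2) ⟨rfl, by simp⟩⟩

/-- The noncommutative `n`-sphere: the flag algebra of the octahedral `n`-sphere. -/
abbrev NCSphere (n : ℕ) : Type := FlagAlgebra (octahedralSphere n)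

/-- The evaluation map of the noncommutative `n`-sphere at a vertex. -/
noncomputable abbrev NCSphere.eval (n : ℕ) (s : Fin (n + 1) × Bool) : NCSphere n →⋆ₐ[ℂ] ℂ :=
  FlagAlgebra.eval (octahedralSphere n) s

end NoncommutativeSphere

end NCFlag

/-! Let `ι` be the unit map from `ℂ` to the noncommutative sphere. Since `ev_s ∘ ι` is the identity
of `ℂ`, it suffices that `ι ∘ ev_s` and the identity agree on K-theory. By the universal property,
homomorphisms to `B` are flag families in `B`, and one shows that every flag family acts on K-theory
like the constant family at any vertex.

The relations couple only the two opposite vertices `i⁺`, `i⁻` of one index, apart from the sum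
condition, which sees only the sums `h_{i⁺} + h_{i⁻}`. Folding an index `j` (moving the `j⁻` entry
into the `j⁺` entry) keeps these sums. Let `T` be the folding of `F` along all indices. In `M₂(B)`,
rotate `diag(F, T)` in the entries of index `j` alone: the sum at `j` is `diag(b, b)`, which
commutes with scalar rotations, so the relations survive. The rotation exchanges the `j`-entries of
`F` and `T`, whence `[F] + [T] = [F folded along j] + [F folded along all indices but j]`
(`KTheoryEq.foldFamily_singleton`).

As `n ≥ 1`, there is an index `l ≠ j`. Both `T` and the folding along all indices but `j` vanish at
`l⁻`, so straight lines join both to the constant family at `l⁺`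
(`KTheoryEq.foldFamily_vertexFamily`). These terms cancel, and folding along `j` is invisible to
K-theory. Folding all indices in turn replaces `F` by `T`, then by the vertex `l⁺`, then by any
vertex of another index. -/

namespace NCFlag

/-! ### Paths of projections and Murray-von Neumann equivalence. -/

section Preliminaries

/-- Matrix algebras over a C*-algebra are C*-algebras. -/
noncomputable instance CStarMatrix.instCStarAlgebraOfSpectralOrder {n B : Type*} [Fintype n]
    [DecidableEq n] [CStarAlgebra B] : CStarAlgebra (CStarMatrix n n B) :=
  letI := CStarAlgebra.spectralOrder B
  haveI := CStarAlgebra.spectralOrderedRing B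
  CStarMatrix.instCStarAlgebra

/-- The element `r` is `|z|⁻¹`, from the functional calculus of `star z * z`, whose spectrum is
strictly positive. It makes `z * r` the unitary part of the polar decomposition of `z`. -/
theorem exists_inv_sqrt {D : Type*} [CStarAlgebra D] (z : D) (hz : IsUnit z) :
    ∃ r : D, IsSelfAdjoint r ∧ r * r * (star z * z) = 1 ∧
      ∀ p : D, Commute (star z * z) p → Commute r p := by
  let _ := CStarAlgebra.spectralOrder D
  have := CStarAlgebra.spectralOrderedRing D
  have hu : IsUnit (star z * z) := hz.star.mul hz
  have hpos : ∀ x ∈ spectrum ℝ (star z * z), 0 < x := fun x hx =>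
    lt_of_le_of_ne (spectrum_nonneg_of_nonneg (star_mul_self_nonneg z) hx)
      fun h => spectrum.zero_notMem ℝ hu (h ▸ hx)
  have hc : ContinuousOn (fun x : ℝ => (√x)⁻¹) (spectrum ℝ (star z * z)) :=
    Real.continuous_sqrt.continuousOn.inv₀ fun x hx => (Real.sqrt_pos.2 (hpos x hx)).ne'
  refine ⟨cfc (fun x : ℝ => (√x)⁻¹) (star z * z), cfc_predicate _ _, ?_, fun p hp => ?_⟩
  · have h1 : cfc (fun x : ℝ => (√x)⁻¹ * (√x)⁻¹) (star z * z) *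
        cfc (fun x : ℝ => x) (star z * z) = 1 := by
      rw [← cfc_mul (fun x : ℝ => (√x)⁻¹ * (√x)⁻¹) (fun x : ℝ => x) _ (hc.mul hc) continuousOn_id,
        ← cfc_one ℝ (star z * z)]
      refine cfc_congr fun x hx => ?_
      have h2 := Real.sq_sqrt (hpos x hx).le
      have h3 := (Real.sqrt_pos.2 (hpos x hx)).ne'
      simp only [Pi.one_apply]
      field_simp
      linarith
    rwa [cfc_mul _ _ _ hc hc, cfc_id' ℝ (star z * z)] at h1
  · exact hp.cfc_real _

/-- Projections `p`, `q` for which `q p + (1 - q) (1 - p)` is invertible are Murray-von Neumann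
equivalent. -/
theorem exists_partialIsometry_of_isUnit {D : Type*} [CStarAlgebra D] {p q : D}
    (hp : IsStarProjection p) (hq : IsStarProjection q)
    (h : IsUnit (q * p + (1 - q) * (1 - p))) : ∃ v : D, v * star v = q ∧ star v * v = p := by
  set z := q * p + (1 - q) * (1 - p) with hz
  have hpp := hp.isIdempotentElem.eq
  have hqq := hq.isIdempotentElem.eq
  have hzp : z * p = q * z := by
    rw [hz]
    have h1 : z * p = q * p := by
      rw [hz]
      simp only [add_mul, mul_sub, sub_mul, mul_one, one_mul, mul_assoc, hpp]
      abel
    have h2 : q * z = q * p := by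
      rw [hz]
      simp only [mul_add, mul_sub, sub_mul, mul_one, one_mul, ← mul_assoc, hqq]
      abel
    rw [← hz, h1, h2]
  have hps : p * star z = star z * q := by
    have := congrArg star hzp
    rwa [star_mul, star_mul, hp.isSelfAdjoint.star_eq, hq.isSelfAdjoint.star_eq] at this
  obtain ⟨r, hr, hrr, hcomm⟩ := exists_inv_sqrt z h
  have hpc : Commute (star z * z) p := by
    rw [Commute, SemiconjBy, mul_assoc, hzp, ← mul_assoc, ← hps, mul_assoc]
  have hrp : r * p = p * r := hcomm p hpc
  have hrz : r * (star z * z) = star z * z * r := hcomm _ (Commute.refl _)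
  -- Cancelling the unit `z` on the right turns `r² z* z = 1` into this identity, so `z * r` is
  -- unitary on both sides.
  have h1 : z * (r * r) * star z = 1 := by
    have : (z * (r * r) * star z) * z = 1 * z := by
      rw [mul_assoc, mul_assoc, hrr, mul_one, one_mul]
    exact h.mul_right_cancel this
  -- The unitary `u = z * r` inherits `u p = q u` from `z`, because `r` commutes with `p`; hence `u
  -- p` is a partial isometry from `p` to `q`.
  refine ⟨z * r * p, ?_, ?_⟩
  · calc z * r * p * star (z * r * p) = z * (r * p * p * r) * star z := by
          rw [star_mul, star_mul, hr.star_eq, hp.isSelfAdjoint.star_eq]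
          simp only [mul_assoc]
      _ = z * (p * (r * r)) * star z := by rw [mul_assoc r, hpp, hrp, mul_assoc p]
      _ = q * (z * (r * r) * star z) := by rw [← mul_assoc z, hzp]; simp only [mul_assoc]
      _ = q := by rw [h1, mul_one]
  · calc star (z * r * p) * (z * r * p) = p * (r * (star z * z)) * r * p := by
          rw [star_mul, star_mul, hr.star_eq, hp.isSelfAdjoint.star_eq]
          simp only [mul_assoc]
      _ = p * (r * r * (star z * z)) * p := by rw [mul_assoc p, mul_assoc r, ← hrz, ← mul_assoc r]
      _ = p := by rw [hrr, mul_one, hpp]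

/-- The endpoints of a path of projections are Murray-von Neumann equivalent. -/
theorem exists_partialIsometry_of_path {D : Type*} [CStarAlgebra D] {X : Type*}
    [TopologicalSpace X] [PreconnectedSpace X] {p : X → D} (hc : Continuous p)
    (hp : ∀ x, IsStarProjection (p x)) (x y : X) : ∃ v : D, v * star v = p x ∧ star v * v = p y := by
  let P : X → X → Prop := fun x y => ∃ v : D, v * star v = p x ∧ star v * v = p y
  have hsymm : Std.Symm P := ⟨fun x y ⟨v, h1, h2⟩ => ⟨star v, by rwa [star_star], by rwa [star_star]⟩⟩
  -- By connectedness it is enough that the relation is symmetric, transitive and true near each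
  -- point. The last holds because the element to be inverted equals `1` at `y = x` and units form
  -- an open set.
  refine PreconnectedSpace.induction₂ P (fun x => ?_) ⟨?_⟩ x y
  · have hcont : Continuous fun y => p x * p y + (1 - p x) * (1 - p y) := by fun_prop
    have h1 : IsUnit (p x * p x + (1 - p x) * (1 - p x)) := by
      rw [(hp x).isIdempotentElem.eq, (hp x).one_sub.isIdempotentElem.eq, add_sub_cancel]
      exact isUnit_one
    filter_upwards [hcont.continuousAt.preimage_mem_nhds (Units.isOpen.mem_nhds h1)] with y hy
    exact exists_partialIsometry_of_isUnit (hp y) (hp x) hy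
  · rintro x y z ⟨v, h1, h2⟩ ⟨w, h3, h4⟩
    refine ⟨v * w, ?_, ?_⟩
    · calc v * w * star (v * w) = v * (w * star w) * star v := by
            rw [star_mul]; simp only [mul_assoc]
        _ = (v * star v) * (v * star v) := by rw [h3, ← h2]; simp only [mul_assoc]
        _ = p x := by rw [h1, (hp x).isIdempotentElem.eq]
    · calc star (v * w) * (v * w) = star w * (star v * v) * w := by
            rw [star_mul]; simp only [mul_assoc]
        _ = (star w * w) * (star w * w) := by rw [h2, ← h3]; simp only [mul_assoc]
        _ = p z := by rw [h4, (hp z).isIdempotentElem.eq]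

/-- `CStarMatrix m m B` is the same type with the same entrywise topology and carries a C*-norm, so
the statement for C*-algebras transfers. -/
theorem MvNEquiv.of_path {B : Type*} [CStarAlgebra B] {m X : Type*} [Fintype m]
    [TopologicalSpace X] [PreconnectedSpace X] {p : X → Matrix m m B} (hc : Continuous p)
    (hp : ∀ x, IsStarProjection (p x)) (x y : X) : MvNEquiv (p x) (p y) := by
  classical
  exact exists_partialIsometry_of_path (D := CStarMatrix m m B) hc
    (fun x => ⟨(hp x).isIdempotentElem, (hp x).isSelfAdjoint⟩) x y

end Preliminaries

/-! ### Classes in `K₁` and block diagonal sums. -/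

section KOneClasses
open scoped unitInterval Matrix
variable {A : Type*} [CStarAlgebra A] {B : Type*} [CStarAlgebra B]

namespace KOne

/-- The class in `K₁` of a unitary matrix. -/
def mk (n : ℕ) (u : UnitaryMatrix A n) : KOne A := Quotient.mk _ ⟨n, PiZero.mk u⟩

theorem mk_mul (n : ℕ) (u v : UnitaryMatrix A n) : mk n (u * v) = mk n u * mk n v := by
  rw [mk, mk, mk, DirectLimit.mul_def, map_mul]

theorem mk_stabilize {m n : ℕ} (h : m ≤ n) (u : UnitaryMatrix A m) :
    mk n (stabilizeUnitary A h u) = mk m u :=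
  (DirectLimit.eq_of_le (F := fun n => PiZero (UnitaryMatrix A n)) (f := piZeroStabilize A)
    ⟨m, PiZero.mk u⟩ n h).symm

theorem mk_eq_of_joined {n : ℕ} {u v : UnitaryMatrix A n} (h : Joined u v) : mk n u = mk n v := by
  have : PiZero.mk u = PiZero.mk v := by
    refine (QuotientGroup.eq (s := Subgroup.pathComponentOne (UnitaryMatrix A n))).2 ?_
    have h1 := h.map (continuous_const_mul u⁻¹)
    rwa [inv_mul_cancel] at h1
  rw [mk, mk, this]

theorem exists_eq_mk (x : KOne A) : ∃ n u, x = mk n u := by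
  refine DirectLimit.induction (piZeroStabilize A) (C := fun x => ∃ n u, x = mk n u)
    (fun n y => ?_) x
  obtain ⟨u, rfl⟩ := PiZero.mk_surjective y
  exact ⟨n, u, rfl⟩

theorem map_mk (φ : A →⋆ₐ[ℂ] B) (n : ℕ) (u : UnitaryMatrix A n) :
    map φ (mk n u) = mk n (mapUnitary φ n u) := rfl

end KOne

/-- Reindexing of unitary matrices. -/
def reindexUnitary {m n : Type*} [Fintype m] [Fintype n] [DecidableEq m] [DecidableEq n]
    (e : m ≃ n) : unitary (Matrix m m B) →* unitary (Matrix n n B) :=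
  (Unitary.map (⟨⟨⟨Matrix.reindex e e, by simp⟩,
    fun a b => by simp [Matrix.submatrix_mul_equiv]⟩, fun a => by
      simp [Matrix.star_eq_conjTranspose]⟩ : Matrix m m B →⋆* Matrix n n B)).toMonoidHom

theorem coe_reindexUnitary {m n : Type*} [Fintype m] [Fintype n] [DecidableEq m] [DecidableEq n]
    (e : m ≃ n) (u : unitary (Matrix m m B)) :
    (reindexUnitary e u : Matrix n n B) = Matrix.reindex e e u.1 := rfl

theorem continuous_reindexUnitary {m n : Type*} [Fintype m] [Fintype n] [DecidableEq m]
    [DecidableEq n] (e : m ≃ n) :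
    Continuous (reindexUnitary e : unitary (Matrix m m B) → unitary (Matrix n n B)) := by
  refine Continuous.subtype_mk ?_ _
  change Continuous fun u : unitary (Matrix m m B) => Matrix.reindex e e u.1
  simp only [Matrix.reindex_apply]
  fun_prop

/-- The block diagonal sum of unitary matrices. -/
def diagUnitary {m n : Type*} [Fintype m] [Fintype n] [DecidableEq m] [DecidableEq n]
    (u : unitary (Matrix m m B)) (v : unitary (Matrix n n B)) : unitary (Matrix (m ⊕ n) (m ⊕ n) B) :=
  ⟨Matrix.fromBlocks u.1 0 0 v.1, by
    have hu := Unitary.mem_iff.1 u.2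
    have hv := Unitary.mem_iff.1 v.2
    simp only [Matrix.star_eq_conjTranspose] at hu hv
    rw [Unitary.mem_iff]
    simp [Matrix.star_eq_conjTranspose, Matrix.fromBlocks_conjTranspose,
      Matrix.fromBlocks_multiply, hu, hv]⟩

theorem joined_of_continuous {D : Type*} [TopologicalSpace D] {S : Set D} (f : I → D)
    (hf : Continuous f) (hS : ∀ t, f t ∈ S) {x y : S} (hx : f 0 = x) (hy : f 1 = y) :
    Joined x y :=
  ⟨⟨⟨fun t => ⟨f t, hS t⟩, hf.subtype_mk _⟩, Subtype.ext hx, Subtype.ext hy⟩⟩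

/-- Rotation by `π t / 2` in two block coordinates. -/
noncomputable def blockRotation (B : Type*) [CStarAlgebra B] (m : Type*) [DecidableEq m] (t : ℝ) :
    Matrix (m ⊕ m) (m ⊕ m) B :=
  Matrix.fromBlocks (((Real.cos (Real.pi / 2 * t) : ℝ) : ℂ) • 1)
    (-((Real.sin (Real.pi / 2 * t) : ℝ) : ℂ) • 1)
    (((Real.sin (Real.pi / 2 * t) : ℝ) : ℂ) • 1) (((Real.cos (Real.pi / 2 * t) : ℝ) : ℂ) • 1)

theorem blockRotation_mem_unitary (m : Type*) [Fintype m] [DecidableEq m] (t : ℝ) :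
    blockRotation B m t ∈ unitary (Matrix (m ⊕ m) (m ⊕ m) B) := by
  have h : ((Real.cos (Real.pi / 2 * t) : ℝ) : ℂ) * ((Real.cos (Real.pi / 2 * t) : ℝ) : ℂ) +
      ((Real.sin (Real.pi / 2 * t) : ℝ) : ℂ) * ((Real.sin (Real.pi / 2 * t) : ℝ) : ℂ) = 1 := by
    rw [← Complex.ofReal_mul, ← Complex.ofReal_mul, ← Complex.ofReal_add, ← sq, ← sq,
      Real.cos_sq_add_sin_sq, Complex.ofReal_one]
  have h' := (add_comm _ _).trans h
  rw [Unitary.mem_iff]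
  constructor <;>
  · rw [blockRotation, Matrix.star_eq_conjTranspose, Matrix.fromBlocks_conjTranspose,
      Matrix.fromBlocks_multiply, ← Matrix.fromBlocks_one]
    simp only [Matrix.conjTranspose_smul, Matrix.conjTranspose_one, mul_one,
      mul_smul_comm, smul_smul, ← add_smul, star_neg, Complex.star_def, Complex.conj_ofReal]
    congr 1
    all_goals
      -- The diagonal blocks reduce to `cos² + sin² = 1`; in the off-diagonal blocks the two
      -- products cancel.
      first
      | (rw [← one_smul ℂ (1 : Matrix m m B)]; simp only [smul_smul]; congr 1; linear_combination h)
      | (convert zero_smul ℂ (1 : Matrix m m B) using 2; ring)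

theorem continuous_blockRotation (m : Type*) [DecidableEq m] : Continuous (blockRotation B m) := by
  unfold blockRotation
  fun_prop

theorem blockRotation_zero (m : Type*) [DecidableEq m] : blockRotation B m 0 = 1 := by
  simp [blockRotation]

theorem blockRotation_one (m : Type*) [DecidableEq m] :
    blockRotation B m 1 = Matrix.fromBlocks 0 (-1) 1 0 := by
  simp [blockRotation]

/-- Conjugation by the rotations joins the two: the quarter turn exchanges the blocks, and its sign
disappears under conjugation. -/
theorem joined_diagUnitary_swap {m : Type*} [Fintype m] [DecidableEq m]
    (u v : unitary (Matrix m m B)) : Joined (diagUnitary u v) (diagUnitary v u) := by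
  refine joined_of_continuous
    (fun t : I => blockRotation B m t * (diagUnitary u v).1 * star (blockRotation B m t)) ?_
    (fun t => ?_) ?_ ?_
  · have := (continuous_blockRotation (B := B) m).comp
      (continuous_subtype_val : Continuous ((↑) : I → ℝ))
    have h2 : Continuous fun t : I => star (blockRotation B m t) := this.star
    fun_prop
  · exact mul_mem (mul_mem (blockRotation_mem_unitary m _) (diagUnitary u v).2)
      (Unitary.star_mem (blockRotation_mem_unitary m _))
  · simp [blockRotation_zero]
  · simp [blockRotation_one, diagUnitary, Matrix.star_eq_conjTranspose,
      Matrix.fromBlocks_conjTranspose, Matrix.fromBlocks_multiply]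

theorem reindexUnitary_diagUnitary_one {m : ℕ} (u : UnitaryMatrix B m) :
    reindexUnitary finSumFinEquiv (diagUnitary u (1 : UnitaryMatrix B m)) =
      stabilizeUnitary B (Nat.le_add_right m m) u := by
  apply Subtype.ext
  ext i j
  obtain ⟨i, rfl⟩ := finSumFinEquiv.surjective i
  obtain ⟨j, rfl⟩ := finSumFinEquiv.surjective j
  rw [coe_reindexUnitary, coe_stabilizeUnitary, stabilizeMatrix_apply, Matrix.reindex_apply,
    Matrix.submatrix_apply, Equiv.symm_apply_apply, Equiv.symm_apply_apply]
  rcases i with i | i <;> rcases j with j | j <;>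
    simp [diagUnitary, Fin.ext_iff, Matrix.one_apply] <;> omega

/-- Split `diag(u, v)` as `diag(u, 1) diag(1, v)` and rotate the second factor to `diag(v, 1)`.
Homotopies in `M₂(B)` produce block sums, and this converts them into products in `K₁`. -/
theorem KOne.mk_diagUnitary {m : ℕ} (u v : UnitaryMatrix B m) :
    mk (m + m) (reindexUnitary finSumFinEquiv (diagUnitary u v)) = mk m u * mk m v := by
  have h1 : diagUnitary u v = diagUnitary u 1 * diagUnitary 1 v := by
    apply Subtype.ext
    simp [diagUnitary, Matrix.fromBlocks_multiply]
  have h2 : mk (m + m) (reindexUnitary finSumFinEquiv (diagUnitary 1 v)) =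
      mk (m + m) (reindexUnitary finSumFinEquiv (diagUnitary v 1)) :=
    mk_eq_of_joined ((joined_diagUnitary_swap 1 v).map (continuous_reindexUnitary _))
  rw [h1, map_mul, mk_mul, h2, reindexUnitary_diagUnitary_one, reindexUnitary_diagUnitary_one,
    mk_stabilize, mk_stabilize]

end KOneClasses
end NCFlag
namespace NCFlag

/-! ### Functoriality of `K₀` and `K₁`. -/

section Functoriality
variable {A B C : Type*} [CStarAlgebra A] [CStarAlgebra B] [CStarAlgebra C]

/-- The Murray-von Neumann class of a matrix projection. -/
def ProjClass.mk (p : MatrixProjection A) : ProjClass A := Quotient.mk _ p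

/-- The class of a matrix projection in `K₀`. -/
def KZero.mk (p : MatrixProjection A) : KZero A :=
  Algebra.GrothendieckAddGroup.of (ProjClass.mk p)

theorem KZero.mk_sum (p q : MatrixProjection A) : mk (p.sum q) = mk p + mk q :=
  map_add Algebra.GrothendieckAddGroup.of (ProjClass.mk p) (ProjClass.mk q)

theorem KZero.mk_eq {p q : MatrixProjection A} (h : MvNEquiv p.mat q.mat) : mk p = mk q :=
  congrArg Algebra.GrothendieckAddGroup.of (Quotient.sound h)

theorem KZero.map_mk (φ : A →⋆ₐ[ℂ] B) (p : MatrixProjection A) :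
    KZero.map φ (mk p) = mk (p.map φ) := by
  have h := (Algebra.GrothendieckAddGroup.lift (M := ProjClass A)).symm_apply_apply
    (Algebra.GrothendieckAddGroup.of.comp (ProjClass.map φ))
  exact DFunLike.congr_fun h (ProjClass.mk p)

theorem KZero.hom_ext {G : Type*} [AddCommGroup G] {f g : KZero A →+ G}
    (h : ∀ p, f (mk p) = g (mk p)) : f = g := by
  apply (Algebra.GrothendieckAddGroup.lift (M := ProjClass A)).symm.injective
  ext x
  obtain ⟨p, rfl⟩ := Quotient.exists_rep x
  exact h p

theorem KZero.map_id : KZero.map (StarAlgHom.id ℂ A) = AddMonoidHom.id _ :=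
  KZero.hom_ext fun p => by
    rw [KZero.map_mk]
    rfl

theorem KZero.map_comp (ψ : B →⋆ₐ[ℂ] C) (φ : A →⋆ₐ[ℂ] B) :
    KZero.map (ψ.comp φ) = (KZero.map ψ).comp (KZero.map φ) :=
  KZero.hom_ext fun p => by
    rw [AddMonoidHom.comp_apply, KZero.map_mk, KZero.map_mk, KZero.map_mk]
    rfl

theorem KOne.hom_ext {G : Type*} [Group G] {f g : KOne A →* G}
    (h : ∀ n u, f (mk n u) = g (mk n u)) : f = g := by
  ext x
  obtain ⟨n, u, rfl⟩ := KOne.exists_eq_mk x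
  exact h n u

theorem KOne.map_id : KOne.map (StarAlgHom.id ℂ A) = MonoidHom.id _ :=
  KOne.hom_ext fun n u => by
    rw [KOne.map_mk]
    rfl

theorem KOne.map_comp (ψ : B →⋆ₐ[ℂ] C) (φ : A →⋆ₐ[ℂ] B) :
    KOne.map (ψ.comp φ) = (KOne.map ψ).comp (KOne.map φ) :=
  KOne.hom_ext fun n u => by
    rw [MonoidHom.comp_apply, KOne.map_mk, KOne.map_mk, KOne.map_mk]
    rfl

end Functoriality

/-! ### Homotopy invariance, with homotopies through `M₂(B)`. -/

section StableHomotopy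
open scoped unitInterval Matrix
variable {A B : Type*} [CStarAlgebra A] [CStarAlgebra B]

/-- Evaluation at `t` of paths in a C*-algebra. -/
def evalHom (D : Type*) [CStarAlgebra D] (t : I) : C(I, D) →⋆ₐ[ℂ] D where
  toFun f := f t
  map_one' := rfl
  map_zero' := rfl
  map_add' _ _ := rfl
  map_mul' _ _ := rfl
  commutes' _ := by simp [Algebra.algebraMap_eq_smul_one]
  map_star' _ := rfl

/-- A continuous path of *-homomorphisms `A → D` as a *-homomorphism `A → C(I, D)`. -/
def pathHom {D : Type*} [CStarAlgebra D] (Φ : I → A →⋆ₐ[ℂ] D) (h : ∀ a, Continuous (Φ · a)) :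
    A →⋆ₐ[ℂ] C(I, D) where
  toFun a := ⟨(Φ · a), h a⟩
  map_one' := ContinuousMap.ext fun t => map_one (Φ t)
  map_zero' := ContinuousMap.ext fun t => map_zero (Φ t)
  map_add' a b := ContinuousMap.ext fun t => map_add (Φ t) a b
  map_mul' a b := ContinuousMap.ext fun t => map_mul (Φ t) a b
  commutes' r := ContinuousMap.ext fun t => by
    simp [Algebra.algebraMap_eq_smul_one]
  map_star' a := ContinuousMap.ext fun t => map_star (Φ t) a

/-- The C*-algebra `M₂(B)`. -/
abbrev TwoByTwo (B : Type*) [CStarAlgebra B] : Type _ := CStarMatrix (Unit ⊕ Unit) (Unit ⊕ Unit) B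

/-- The diagonal embedding `B × B → M₂(B)`. -/
noncomputable def diagHom (B : Type*) [CStarAlgebra B] : B × B →⋆ₐ[ℂ] TwoByTwo B where
  toFun x := CStarMatrix.ofMatrix (Matrix.fromBlocks (Matrix.of fun _ _ => x.1) 0 0
    (Matrix.of fun _ _ => x.2))
  map_one' := by ext (i | i) (j | j) <;> simp
  map_zero' := by ext (i | i) (j | j) <;> simp
  map_add' x y := by ext (i | i) (j | j) <;> simp
  map_mul' x y := by ext (i | i) (j | j) <;> simp [CStarMatrix.mul_apply]
  commutes' r := by
    ext (i | i) (j | j) <;> simp [CStarMatrix.algebraMap_apply]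
  map_star' x := by ext (i | i) (j | j) <;> simp [CStarMatrix.star_apply]

theorem continuous_diagHom (B : Type*) [CStarAlgebra B] : Continuous (diagHom B) := by
  refine continuous_matrix ?_
  rintro (i | i) (j | j)
  · exact continuous_fst
  · exact continuous_const
  · exact continuous_const
  · exact continuous_snd

/-- The map `M_m(A) → M_{2m}(B)` induced by a *-homomorphism `A → M₂(B)`. -/
noncomputable def blockHom (Φ : A →⋆ₐ[ℂ] TwoByTwo B) (m : Type*) [Fintype m] [DecidableEq m] :
    Matrix m m A →⋆* Matrix (m ⊕ m) (m ⊕ m) B where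
  -- The index of `M₂` is placed outside that of `M_m`, so that a diagonal `Φ` yields a block
  -- diagonal sum without any reindexing.
  toFun u := Matrix.fromBlocks (u.map fun a => Φ a (.inl ()) (.inl ()))
    (u.map fun a => Φ a (.inl ()) (.inr ())) (u.map fun a => Φ a (.inr ()) (.inl ()))
    (u.map fun a => Φ a (.inr ()) (.inr ()))
  map_one' := by
    have h (i j : m) (x y) : Φ ((1 : Matrix m m A) i j) x y =
        if i = j then (if x = y then 1 else 0) else 0 := by
      rw [Matrix.one_apply]
      split_ifs with h1 h2 <;> simp [*]
    ext (i | i) (j | j) <;> simp only [Matrix.fromBlocks_apply₁₁, Matrix.fromBlocks_apply₁₂,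
      Matrix.fromBlocks_apply₂₁, Matrix.fromBlocks_apply₂₂, Matrix.map_apply, h] <;>
      simp [Matrix.one_apply]
  map_mul' u v := by
    have h (i j : m) (x y) : Φ ((u * v) i j) x y = ∑ k,
        (Φ (u i k) x (.inl ()) * Φ (v k j) (.inl ()) y +
          Φ (u i k) x (.inr ()) * Φ (v k j) (.inr ()) y) := by
      rw [Matrix.mul_apply, map_sum]
      have (s : Finset m) (f : m → TwoByTwo B) : (∑ k ∈ s, f k) x y = ∑ k ∈ s, f k x y := by
        induction s using Finset.cons_induction with
        | empty => simp
        | cons a s ha ih => rw [Finset.sum_cons, Finset.sum_cons, CStarMatrix.add_apply, ih]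
      simp [this, CStarMatrix.mul_apply]
    ext (i | i) (j | j) <;> simp only [Matrix.fromBlocks_apply₁₁, Matrix.fromBlocks_apply₁₂,
      Matrix.fromBlocks_apply₂₁, Matrix.fromBlocks_apply₂₂, Matrix.map_apply, h] <;>
      simp [Matrix.mul_apply, Finset.sum_add_distrib]
  map_star' u := by
    have h (i j : m) (x y) : Φ (star u i j) x y = star (Φ (u j i) y x) := by
      rw [Matrix.star_apply, map_star, CStarMatrix.star_apply]
    ext (i | i) (j | j) <;> simp only [Matrix.fromBlocks_apply₁₁, Matrix.fromBlocks_apply₁₂,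
      Matrix.fromBlocks_apply₂₁, Matrix.fromBlocks_apply₂₂, Matrix.map_apply, h] <;> rfl

theorem blockHom_of_eq_diag {Φ : A →⋆ₐ[ℂ] TwoByTwo B} {φ ψ : A →⋆ₐ[ℂ] B}
    (h : ∀ a, Φ a = diagHom B (φ a, ψ a)) {m : Type*} [Fintype m] [DecidableEq m]
    (u : Matrix m m A) : blockHom Φ m u = Matrix.fromBlocks (u.map φ) 0 0 (u.map ψ) := by
  ext (i | i) (j | j) <;> simp [blockHom, h, diagHom]

theorem continuous_blockHom (Φ : A →⋆ₐ[ℂ] C(I, TwoByTwo B)) {m : Type*} [Fintype m]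
    [DecidableEq m] (u : Matrix m m A) :
    Continuous fun t : I => blockHom ((evalHom (TwoByTwo B) t).comp Φ) m u := by
  have h (a : A) (x y) : Continuous fun t : I => Φ a t x y :=
    (continuous_apply_apply x y).comp (map_continuous (Φ a))
  refine Continuous.matrix_fromBlocks ?_ ?_ ?_ ?_ <;>
    exact continuous_matrix fun i j => h _ _ _

variable {φ₁ φ₂ ψ₁ ψ₂ : A →⋆ₐ[ℂ] B}

/-- A homotopy in `M₂(B)` between `diag(φ₁, φ₂)` and `diag(ψ₁, ψ₂)` gives an identity in `K₀`. -/
theorem KZero.map_add_map_eq (Φ : A →⋆ₐ[ℂ] C(I, TwoByTwo B))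
    (h₀ : ∀ a, Φ a 0 = diagHom B (φ₁ a, φ₂ a)) (h₁ : ∀ a, Φ a 1 = diagHom B (ψ₁ a, ψ₂ a)) :
    KZero.map φ₁ + KZero.map φ₂ = KZero.map ψ₁ + KZero.map ψ₂ := by
  refine KZero.hom_ext fun p => ?_
  simp only [AddMonoidHom.add_apply, KZero.map_mk, ← KZero.mk_sum]
  apply KZero.mk_eq
  refine (MatrixProjection.sum_equiv _ _).symm.trans (MatrixProjection.isStarProjection _)
    (MatrixProjection.isStarProjection _) (.trans ?_ (MatrixProjection.isStarProjection _) ?_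
      (MatrixProjection.sum_equiv _ _))
  · exact (p.map φ₁).isStarProjection.matrix_fromBlocks (p.map φ₂).isStarProjection
  -- Evaluating the homotopy on `p` gives a path of projections whose endpoints are the two block
  -- sums.
  · have h := MvNEquiv.of_path (continuous_blockHom Φ p.mat)
      (fun t => p.isStarProjection.map
        (blockHom ((evalHom (TwoByTwo B) t).comp Φ) (Fin p.size))) (0 : I) 1
    rw [blockHom_of_eq_diag (Φ := (evalHom (TwoByTwo B) 0).comp Φ) h₀,
      blockHom_of_eq_diag (Φ := (evalHom (TwoByTwo B) 1).comp Φ) h₁] at h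
    exact h

/-- A homotopy in `M₂(B)` between `diag(φ₁, φ₂)` and `diag(ψ₁, ψ₂)` gives an identity in `K₁`. -/
theorem KOne.map_mul_map_eq (Φ : A →⋆ₐ[ℂ] C(I, TwoByTwo B))
    (h₀ : ∀ a, Φ a 0 = diagHom B (φ₁ a, φ₂ a)) (h₁ : ∀ a, Φ a 1 = diagHom B (ψ₁ a, ψ₂ a))
    (x : KOne A) : KOne.map φ₁ x * KOne.map φ₂ x = KOne.map ψ₁ x * KOne.map ψ₂ x := by
  obtain ⟨m, u, rfl⟩ := KOne.exists_eq_mk x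
  simp only [KOne.map_mk, ← KOne.mk_diagUnitary]
  refine KOne.mk_eq_of_joined (Joined.map ?_ (continuous_reindexUnitary _))
  exact joined_of_continuous _ (continuous_blockHom Φ u.1)
    (fun t => Unitary.map_mem (blockHom ((evalHom (TwoByTwo B) t).comp Φ) (Fin m)) u.2) 
    (blockHom_of_eq_diag (Φ := (evalHom (TwoByTwo B) 0).comp Φ) h₀ _)
    (blockHom_of_eq_diag (Φ := (evalHom (TwoByTwo B) 1).comp Φ) h₁ _)

/-- Two *-homomorphisms induce the same maps in K-theory. -/
def KTheoryEq (φ ψ : A →⋆ₐ[ℂ] B) : Prop := KZero.map φ = KZero.map ψ ∧ KOne.map φ = KOne.map ψ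

theorem KTheoryEq.symm {φ ψ : A →⋆ₐ[ℂ] B} (h : KTheoryEq φ ψ) : KTheoryEq ψ φ :=
  ⟨h.1.symm, h.2.symm⟩

theorem KTheoryEq.trans {φ ψ χ : A →⋆ₐ[ℂ] B} (h : KTheoryEq φ ψ) (h' : KTheoryEq ψ χ) :
    KTheoryEq φ χ :=
  ⟨h.1.trans h'.1, h.2.trans h'.2⟩

/-- K-groups have cancellation, so summands that agree on K-theory can be removed from a homotopy of
diagonal sums. -/
theorem KTheoryEq.of_stable_homotopy (Φ : A →⋆ₐ[ℂ] C(I, TwoByTwo B))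
    (h₀ : ∀ a, Φ a 0 = diagHom B (φ₁ a, φ₂ a)) (h₁ : ∀ a, Φ a 1 = diagHom B (ψ₁ a, ψ₂ a))
    (h : KTheoryEq φ₂ ψ₂) : KTheoryEq φ₁ ψ₁ := by
  constructor
  · have := KZero.map_add_map_eq Φ h₀ h₁
    rwa [h.1, add_left_inj] at this
  · ext x
    have := KOne.map_mul_map_eq Φ h₀ h₁ x
    rwa [h.2, mul_left_inj] at this

/-- Homotopy invariance of K-theory. -/
theorem KTheoryEq.of_homotopy {φ ψ : A →⋆ₐ[ℂ] B} (Φ : A →⋆ₐ[ℂ] C(I, B)) (h₀ : ∀ a, Φ a 0 = φ a)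
    (h₁ : ∀ a, Φ a 1 = ψ a) : KTheoryEq φ ψ := by
  have hc (a : A) : Continuous fun t : I => diagHom B (Φ a t, φ a) := by
    refine (continuous_diagHom B).comp (by fun_prop)
  -- An ordinary homotopy becomes one in `M₂(B)` by keeping `φ` constant in the second corner.
  refine KTheoryEq.of_stable_homotopy (φ₂ := φ) (ψ₂ := φ)
    (pathHom (fun t => (diagHom B).comp (((evalHom B t).comp Φ).prod φ)) hc)
    (fun a => ?_) (fun a => ?_) ⟨rfl, rfl⟩
  · exact congrArg (fun b => diagHom B (b, φ a)) (h₀ a)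
  · exact congrArg (fun b => diagHom B (b, φ a)) (h₁ a)

end StableHomotopy
end NCFlag
namespace NCFlag

/-! ### Flag families of the octahedral sphere and their foldings. -/

section FlagFamilies
open scoped unitInterval

/-- An element of the form `b* b`. -/
def IsStarSquare {D : Type*} [CStarAlgebra D] (x : D) : Prop := ∃ b : D, x = star b * b

namespace IsStarSquare
variable {D E : Type*} [CStarAlgebra D] [CStarAlgebra E] {x y : D}

theorem zero : IsStarSquare (0 : D) := ⟨0, by simp⟩

/-- No explicit root is written down here: the sum is nonnegative in the spectral order, and
nonnegative elements are star squares. -/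
theorem add (hx : IsStarSquare x) (hy : IsStarSquare y) : IsStarSquare (x + y) := by
  let _ := CStarAlgebra.spectralOrder D
  have := CStarAlgebra.spectralOrderedRing D
  obtain ⟨a, rfl⟩ := hx
  obtain ⟨b, rfl⟩ := hy
  exact CStarAlgebra.nonneg_iff_eq_star_mul_self.1
    (add_nonneg (star_mul_self_nonneg a) (star_mul_self_nonneg b))

theorem map (φ : D →⋆ₐ[ℂ] E) (hx : IsStarSquare x) : IsStarSquare (φ x) := by
  obtain ⟨a, rfl⟩ := hx
  exact ⟨φ a, by rw [map_mul, map_star]⟩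

theorem conj (r : D) (hx : IsStarSquare x) : IsStarSquare (r * x * star r) := by
  obtain ⟨a, rfl⟩ := hx
  exact ⟨a * star r, by rw [star_mul, star_star]; simp only [mul_assoc]⟩

theorem smul_path {X : Type*} [TopologicalSpace X] [CompactSpace X] (f : C(X, ℝ)) (hf : ∀ t, 0 ≤ f t)
    (hx : IsStarSquare x) :
    IsStarSquare (⟨fun t => (f t : ℂ) • x, by fun_prop⟩ : C(X, D)) := by
  obtain ⟨a, rfl⟩ := hx
  refine ⟨⟨fun t => ((√(f t) : ℝ) : ℂ) • a, by fun_prop⟩, ContinuousMap.ext fun t => ?_⟩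
  change (f t : ℂ) • (star a * a) = star (((√(f t) : ℝ) : ℂ) • a) * (((√(f t) : ℝ) : ℂ) • a)
  rw [star_smul, smul_mul_smul_comm, Complex.star_def, Complex.conj_ofReal, ← Complex.ofReal_mul,
    Real.mul_self_sqrt (hf t)]

end IsStarSquare

variable {n : ℕ} {B D : Type*} [CStarAlgebra B] [CStarAlgebra D]

theorem IsFlagFamily.map {V : Type} [Fintype V] [DecidableEq V] {K : AbstractSimplicialComplex V}
    {F : V → B} (hF : IsFlagFamily K F) (φ : B →⋆ₐ[ℂ] D) : IsFlagFamily K fun s => φ (F s) where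
  pos s := IsStarSquare.map φ (hF.pos s)
  mul_eq_zero s t hst := by rw [← map_mul, hF.mul_eq_zero s t hst, map_zero]
  sum_eq_one := by rw [← map_sum, hF.sum_eq_one, map_one]

/-- In this form, different indices interact only through the sums `F (i, true) + F (i, false)`. One
index can therefore be modified independently of the others as long as its sum is kept. -/
theorem isFlagFamily_octahedralSphere_iff {F : Fin (n + 1) × Bool → B} :
    IsFlagFamily (octahedralSphere n) F ↔ (∀ s, IsStarSquare (F s)) ∧
      (∀ i b, F (i, b) * F (i, !b) = 0) ∧ ∑ i, (F (i, true) + F (i, false)) = 1 := by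
  have hsum : ∑ i, (F (i, true) + F (i, false)) = ∑ s, F s := by
    rw [Fintype.sum_prod_type]
    simp
  rw [hsum]
  refine ⟨fun h => ⟨h.pos, fun i b => h.mul_eq_zero _ _ ?_, h.sum_eq_one⟩,
    fun ⟨h1, h2, h3⟩ => ⟨h1, ?_, h3⟩⟩
  · rw [pair_mem_octahedralSphere_iff]
    simp
  · rintro ⟨i, b⟩ ⟨j, c⟩ h
    rw [pair_mem_octahedralSphere_iff, not_not] at h
    obtain ⟨rfl : i = j, hbc⟩ := h
    obtain rfl : c = !b := by
      revert hbc
      cases b <;> cases c <;> simp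
    exact h2 i b

/-- The family obtained from `F` by collapsing `i⁻` to `i⁺`, for `i ∈ S`. -/
def foldFamily (S : Finset (Fin (n + 1))) (F : Fin (n + 1) × Bool → B) : Fin (n + 1) × Bool → B :=
  fun s => if s.1 ∈ S then (if s.2 then F (s.1, true) + F (s.1, false) else 0) else F s

theorem foldFamily_sum (S : Finset (Fin (n + 1))) (F : Fin (n + 1) × Bool → B) (i : Fin (n + 1)) :
    foldFamily S F (i, true) + foldFamily S F (i, false) = F (i, true) + F (i, false) := by
  by_cases h : i ∈ S <;> simp [foldFamily, h]

theorem foldFamily_empty (F : Fin (n + 1) × Bool → B) : foldFamily ∅ F = F := by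
  ext s
  simp [foldFamily]

/-- This reduces folding along a set to folding one index at a time. -/
theorem foldFamily_singleton_foldFamily (j : Fin (n + 1)) (S : Finset (Fin (n + 1)))
    (F : Fin (n + 1) × Bool → B) :
    foldFamily {j} (foldFamily S F) = foldFamily (insert j S) F := by
  ext ⟨i, b⟩
  by_cases hi : i = j <;> by_cases hS : i ∈ S <;> cases b <;> simp [foldFamily, *]
  all_goals subst hi; simp [hS]

theorem IsFlagFamily.foldFamily {F : Fin (n + 1) × Bool → B}
    (hF : IsFlagFamily (octahedralSphere n) F) (S : Finset (Fin (n + 1))) :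
    IsFlagFamily (octahedralSphere n) (foldFamily S F) := by
  rw [isFlagFamily_octahedralSphere_iff] at hF ⊢
  obtain ⟨h1, h2, h3⟩ := hF
  refine ⟨fun s => ?_, fun i b => ?_, ?_⟩
  · unfold NCFlag.foldFamily
    split_ifs
    · exact (h1 _).add (h1 _)
    · exact .zero
    · exact h1 s
  · by_cases h : i ∈ S <;> cases b <;> simp [NCFlag.foldFamily, h]
    · exact h2 i false
    · exact h2 i true
  · simpa only [foldFamily_sum] using h3

end FlagFamilies

/-! ### Straight-line homotopies of flag families. -/

section Homotopies
open scoped unitInterval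
variable {n : ℕ} {B : Type} [CStarAlgebra B]

/-- Two flag families are homotopic by a straight line as soon as they are compatible. -/
theorem KTheoryEq.of_linear_homotopy {F G : Fin (n + 1) × Bool → B}
    (hF : IsFlagFamily (octahedralSphere n) F) (hG : IsFlagFamily (octahedralSphere n) G)
    (hFG : ∀ i b, F (i, b) * G (i, !b) = 0) (hGF : ∀ i b, G (i, b) * F (i, !b) = 0) :
    KTheoryEq (FlagAlgebra.lift F hF) (FlagAlgebra.lift G hG) := by
  let H : Fin (n + 1) × Bool → C(I, B) := fun s =>
    ⟨fun t => (((1 - t : ℝ) : ℂ) • F s), by fun_prop⟩ + ⟨fun t => ((t : ℝ) : ℂ) • G s, by fun_prop⟩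
  have hF' := isFlagFamily_octahedralSphere_iff.1 hF
  have hG' := isFlagFamily_octahedralSphere_iff.1 hG
  have hH : IsFlagFamily (octahedralSphere n) H := by
    refine isFlagFamily_octahedralSphere_iff.2 ⟨fun s => ?_, fun i b => ?_, ?_⟩
    · exact (IsStarSquare.smul_path ⟨fun t : I => 1 - (t : ℝ), by fun_prop⟩
        (fun t => sub_nonneg.2 t.2.2) (hF'.1 s)).add (IsStarSquare.smul_path
          ⟨fun t : I => (t : ℝ), by fun_prop⟩ (fun t => t.2.1) (hG'.1 s))
    -- The product expands into four terms; the mixed ones vanish by `hFG` and `hGF`, the pure ones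
    -- by the relations of `F` and `G`.
    · ext t
      simp [H, mul_add, add_mul, hFG, hGF, hF'.2.1, hG'.2.1]
    · ext t
      have h : ∀ i, (H (i, true) + H (i, false)) t = ((1 - t : ℝ) : ℂ) • (F (i, true) + F (i, false))
          + ((t : ℝ) : ℂ) • (G (i, true) + G (i, false)) := fun i => by
        simp only [H, ContinuousMap.add_apply, ContinuousMap.coe_mk, smul_add]
        abel
      rw [ContinuousMap.sum_apply]
      simp only [h]
      rw [Finset.sum_add_distrib, ← Finset.smul_sum, ← Finset.smul_sum, hF'.2.2, hG'.2.2,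
        ← add_smul]
      simp
  refine KTheoryEq.of_homotopy (FlagAlgebra.lift H hH) (fun a => ?_) (fun a => ?_)
  · refine DFunLike.congr_fun (f := (evalHom B 0).comp (FlagAlgebra.lift H hH))
      (FlagAlgebra.hom_ext fun s => ?_) a
    rw [StarAlgHom.comp_apply, FlagAlgebra.lift_h, FlagAlgebra.lift_h]
    change ((1 - (0 : I) : ℝ) : ℂ) • F s + (((0 : I) : ℝ) : ℂ) • G s = F s
    simp
  · refine DFunLike.congr_fun (f := (evalHom B 1).comp (FlagAlgebra.lift H hH))
      (FlagAlgebra.hom_ext fun s => ?_) a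
    rw [StarAlgHom.comp_apply, FlagAlgebra.lift_h, FlagAlgebra.lift_h]
    change ((1 - (1 : I) : ℝ) : ℂ) • F s + (((1 : I) : ℝ) : ℂ) • G s = G s
    simp

/-! ### Rotation of a single index in `M₂(B)`. -/

/-- The constant path in a C*-algebra. -/
def constHom (D : Type*) [CStarAlgebra D] : D →⋆ₐ[ℂ] C(I, D) :=
  pathHom (fun _ => StarAlgHom.id ℂ D) fun _ => continuous_const

/-- The path of rotations in `M₂(B)`. -/
noncomputable def rotationPath (B : Type*) [CStarAlgebra B] : C(I, TwoByTwo B) :=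
  ⟨fun t => blockRotation B Unit t, (continuous_blockRotation Unit).comp continuous_subtype_val⟩

theorem rotationPath_mul_star : rotationPath B * star (rotationPath B) = 1 :=
  ContinuousMap.ext fun t => (Unitary.mem_iff.1 (blockRotation_mem_unitary Unit (t : ℝ))).2

theorem star_mul_rotationPath : star (rotationPath B) * rotationPath B = 1 :=
  ContinuousMap.ext fun t => (Unitary.mem_iff.1 (blockRotation_mem_unitary Unit (t : ℝ))).1

/-- The rotations have scalar entries and so commute with `diag(b, b)`. This keeps the sum over an
index fixed while that index is rotated. -/
theorem rotationPath_mul_diag (b : B) :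
    rotationPath B * constHom _ (diagHom B (b, b)) * star (rotationPath B) =
      constHom _ (diagHom B (b, b)) := by
  have h : rotationPath B * constHom _ (diagHom B (b, b)) =
      constHom _ (diagHom B (b, b)) * rotationPath B := by
    refine ContinuousMap.ext fun t => ?_
    change blockRotation B Unit t * (Matrix.fromBlocks (Matrix.of fun _ _ => b) 0 0
      (Matrix.of fun _ _ => b) : Matrix (Unit ⊕ Unit) (Unit ⊕ Unit) B) =
      (Matrix.fromBlocks (Matrix.of fun _ _ => b) 0 0
      (Matrix.of fun _ _ => b) : Matrix (Unit ⊕ Unit) (Unit ⊕ Unit) B) * blockRotation B Unit t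
    simp [blockRotation, Matrix.fromBlocks_multiply]
  rw [h, mul_assoc, rotationPath_mul_star, mul_one]

theorem rotationPath_conj_zero (x : TwoByTwo B) :
    (rotationPath B * constHom _ x * star (rotationPath B)) 0 = x := by
  have h : rotationPath B 0 = 1 := blockRotation_zero Unit
  change rotationPath B 0 * x * star (rotationPath B 0) = x
  rw [h, star_one, one_mul, mul_one]

theorem rotationPath_conj_one (a b : B) :
    (rotationPath B * constHom _ (diagHom B (a, b)) * star (rotationPath B)) 1 =
      diagHom B (b, a) := by
  change blockRotation B Unit 1 * (Matrix.fromBlocks (Matrix.of fun _ _ => a) 0 0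
    (Matrix.of fun _ _ => b) : Matrix (Unit ⊕ Unit) (Unit ⊕ Unit) B) *
    (blockRotation B Unit 1).conjTranspose = (Matrix.fromBlocks (Matrix.of fun _ _ => b) 0 0
      (Matrix.of fun _ _ => a) : Matrix (Unit ⊕ Unit) (Unit ⊕ Unit) B)
  rw [blockRotation_one]
  simp [Matrix.fromBlocks_conjTranspose, Matrix.fromBlocks_multiply]

/-- Exchanging the `j`-th coordinates of a flag family and of its total folding by a rotation. -/
theorem KTheoryEq.foldFamily_singleton {F : Fin (n + 1) × Bool → B}
    (hF : IsFlagFamily (octahedralSphere n) F) (j : Fin (n + 1))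
    (h : KTheoryEq (FlagAlgebra.lift _ (hF.foldFamily Finset.univ))
      (FlagAlgebra.lift _ (hF.foldFamily {j}ᶜ))) :
    KTheoryEq (FlagAlgebra.lift F hF) (FlagAlgebra.lift _ (hF.foldFamily {j})) := by
  let T := foldFamily Finset.univ F
  have hT : IsFlagFamily (octahedralSphere n) T := hF.foldFamily Finset.univ
  let R := rotationPath B
  let d : Fin (n + 1) × Bool → C(I, TwoByTwo B) := fun s => constHom _ (diagHom B (F s, T s))
  -- Rotating index `j` alone is harmless: its two entries are conjugated by the same unitary and
  -- remain orthogonal, and their sum is `diag(b, b)`, since `F` and `T` have the same sum at `j`.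
  let H : Fin (n + 1) × Bool → C(I, TwoByTwo B) := fun s =>
    if s.1 = j then R * d s * star R else d s
  have hF' := isFlagFamily_octahedralSphere_iff.1 hF
  have hT' := isFlagFamily_octahedralSphere_iff.1 hT
  have hdpos (s) : IsStarSquare (d s) := by
    refine IsStarSquare.map _ (IsStarSquare.map _ ?_)
    obtain ⟨a, ha⟩ := hF'.1 s
    obtain ⟨b, hb⟩ := hT'.1 s
    exact ⟨(a, b), Prod.ext ha hb⟩
  have hdmul (i b) : d (i, b) * d (i, !b) = 0 := by
    change constHom _ _ * constHom _ _ = 0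
    rw [← map_mul, ← map_mul, Prod.mk_mul_mk, hF'.2.1, hT'.2.1, Prod.mk_zero_zero, map_zero,
      map_zero]
  have hdsum (i) : d (i, true) + d (i, false) =
      constHom _ (diagHom B (F (i, true) + F (i, false), F (i, true) + F (i, false))) := by
    change constHom _ _ + constHom _ _ = _
    rw [← map_add, ← map_add, Prod.mk_add_mk, foldFamily_sum]
  have hH : IsFlagFamily (octahedralSphere n) H := by
    refine isFlagFamily_octahedralSphere_iff.2 ⟨fun s => ?_, fun i b => ?_, ?_⟩
    · simp only [H]
      split_ifs
      · exact (hdpos s).conj R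
      · exact hdpos s
    · by_cases hi : i = j
      · simp only [H, hi, if_true]
        rw [← hi]
        calc R * d (i, b) * star R * (R * d (i, !b) * star R)
            = R * (d (i, b) * (star R * R) * d (i, !b)) * star R := by simp only [mul_assoc]
          _ = 0 := by rw [star_mul_rotationPath, mul_one, hdmul, mul_zero, zero_mul]
      · simp only [H, hi, if_false, hdmul]
    · have hHsum (i) : H (i, true) + H (i, false) =
          constHom _ (diagHom B (F (i, true) + F (i, false), F (i, true) + F (i, false))) := by
        by_cases hi : i = j
        · simp only [H, hi, if_true]
          rw [← hi, ← add_mul, ← mul_add, hdsum, rotationPath_mul_diag]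
        · simp only [H, hi, if_false, hdsum]
      simp only [hHsum]
      rw [← map_sum, ← map_sum]
      have h2 : ∑ i, (F (i, true) + F (i, false), F (i, true) + F (i, false)) = 1 := by
        refine Prod.ext ?_ ?_
        · rw [Prod.fst_sum]; exact hF'.2.2
        · rw [Prod.snd_sum]; exact hF'.2.2
      rw [h2, map_one, map_one]
  -- At time `1` the `j`-entries of `F` and `T` have changed places. The first corner is then `F`
  -- folded along `j` only, the second `F` folded everywhere except at `j`; `h` cancels the second
  -- corners.
  refine KTheoryEq.of_stable_homotopy (FlagAlgebra.lift H hH) (fun a => ?_) (fun a => ?_) h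
  · refine DFunLike.congr_fun (f := (evalHom _ 0).comp (FlagAlgebra.lift H hH))
      (g := (diagHom B).comp ((FlagAlgebra.lift F hF).prod (FlagAlgebra.lift T hT)))
      (FlagAlgebra.hom_ext fun s => ?_) a
    simp only [StarAlgHom.comp_apply, StarAlgHom.prod_apply, FlagAlgebra.lift_h]
    change H s 0 = _
    by_cases hs : s.1 = j
    · simp only [H, hs, if_true]
      exact rotationPath_conj_zero _
    · simp only [H, hs, if_false]
      rfl
  · refine DFunLike.congr_fun (f := (evalHom _ 1).comp (FlagAlgebra.lift H hH))
      (g := (diagHom B).comp ((FlagAlgebra.lift _ (hF.foldFamily {j})).prod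
        (FlagAlgebra.lift _ (hF.foldFamily {j}ᶜ))))
      (FlagAlgebra.hom_ext fun s => ?_) a
    simp only [StarAlgHom.comp_apply, StarAlgHom.prod_apply, FlagAlgebra.lift_h]
    change H s 1 = _
    by_cases hs : s.1 = j
    · simp only [H, hs, if_true]
      refine (rotationPath_conj_one _ _).trans ?_
      simp [foldFamily, T, hs]
    · simp only [H, hs, if_false]
      change diagHom B _ = _
      simp [foldFamily, T, hs]

/-! ### Comparison with evaluations at vertices. -/

/-- The constant flag family at a vertex. -/
def vertexFamily (B : Type*) [CStarAlgebra B] (v : Fin (n + 1) × Bool) : Fin (n + 1) × Bool → B :=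
  fun s => StarAlgHom.ofId ℂ B ((Pi.single v 1 : Fin (n + 1) × Bool → ℂ) s)

theorem vertexFamily_of_ne {v s : Fin (n + 1) × Bool} (h : s ≠ v) : vertexFamily B v s = 0 := by
  simp [vertexFamily, h]

theorem isFlagFamily_vertexFamily (v : Fin (n + 1) × Bool) :
    IsFlagFamily (octahedralSphere n) (vertexFamily B v) :=
  (FlagAlgebra.isFlagFamily_single _ v).map _

theorem lift_vertexFamily (v : Fin (n + 1) × Bool) :
    FlagAlgebra.lift _ (isFlagFamily_vertexFamily (B := B) v) =
      (StarAlgHom.ofId ℂ B).comp (NCSphere.eval n v) := by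
  refine FlagAlgebra.hom_ext fun s => ?_
  rw [FlagAlgebra.lift_h, StarAlgHom.comp_apply]
  exact (congrArg (StarAlgHom.ofId ℂ B) (FlagAlgebra.lift_h _ s)).symm

/-- A flag family folded along `l` is homotopic to the constant family at `l⁺`. -/
theorem KTheoryEq.foldFamily_vertexFamily {F : Fin (n + 1) × Bool → B}
    (hF : IsFlagFamily (octahedralSphere n) F) {S : Finset (Fin (n + 1))} {l : Fin (n + 1)}
    (hl : l ∈ S) : KTheoryEq (FlagAlgebra.lift _ (hF.foldFamily S))
      (FlagAlgebra.lift _ (isFlagFamily_vertexFamily (l, true))) := by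
  -- The vertex family lives only at `l⁺`, and the entry opposite to it is zero in a family folded
  -- along `l`; hence all mixed products vanish.
  have h : ∀ i b, foldFamily S F (i, b) = 0 ∨ vertexFamily B (l, true) (i, !b) = 0 := by
    intro i b
    by_cases hi : ((i, !b) : Fin (n + 1) × Bool) = (l, true)
    · left
      obtain ⟨rfl, hb⟩ := Prod.ext_iff.1 hi
      obtain rfl : b = false := by simpa using hb
      simp [foldFamily, hl]
    · exact .inr (vertexFamily_of_ne hi)
  refine KTheoryEq.of_linear_homotopy _ _ (fun i b => ?_) (fun i b => ?_)
  · rcases h i b with h | h <;> simp [h]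
  · rcases h i (!b) with h | h
    · simp [h]
    · rw [Bool.not_not] at h
      simp [h]

/-- Vertices with distinct indices span an edge of the octahedral sphere, along which one moves in a
straight line. -/
theorem KTheoryEq.vertexFamily_vertexFamily {v w : Fin (n + 1) × Bool} (h : v.1 ≠ w.1) :
    KTheoryEq (FlagAlgebra.lift _ (isFlagFamily_vertexFamily (B := B) v))
      (FlagAlgebra.lift _ (isFlagFamily_vertexFamily w)) := by
  have key : ∀ i b c, vertexFamily B v (i, b) = 0 ∨ vertexFamily B w (i, c) = 0 := by
    intro i b c
    by_cases hi : i = v.1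
    · exact .inr (vertexFamily_of_ne fun h' => h (hi ▸ congrArg Prod.fst h'))
    · exact .inl (vertexFamily_of_ne fun h' => hi (congrArg Prod.fst h'))
  refine KTheoryEq.of_linear_homotopy _ _ (fun i b => ?_) (fun i b => ?_)
  · rcases key i b (!b) with h | h <;> simp [h]
  · rcases key i (!b) b with h | h <;> simp [h]

theorem KTheoryEq.foldFamily (hn : 1 ≤ n) {F : Fin (n + 1) × Bool → B}
    (hF : IsFlagFamily (octahedralSphere n) F) (S : Finset (Fin (n + 1))) :
    KTheoryEq (FlagAlgebra.lift F hF) (FlagAlgebra.lift _ (hF.foldFamily S)) := by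
  have : Nontrivial (Fin (n + 1)) := Fin.nontrivial_iff_two_le.2 (by omega)
  induction S using Finset.induction_on with
  | empty =>
    simp only [foldFamily_empty]
    exact ⟨rfl, rfl⟩
  | insert j S _ ih =>
    refine ih.trans ?_
    -- This needs `1 ≤ n`. Since `l` lies in both `univ` and `{j}ᶜ`, both foldings are equivalent to
    -- the vertex `l⁺`, which is the cancellation hypothesis of `KTheoryEq.foldFamily_singleton`.
    obtain ⟨l, hl⟩ := exists_ne j
    have h := KTheoryEq.foldFamily_singleton (hF.foldFamily S) j
      ((KTheoryEq.foldFamily_vertexFamily (hF.foldFamily S) (Finset.mem_univ l)).trans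
        (KTheoryEq.foldFamily_vertexFamily (hF.foldFamily S) (by simpa using hl)).symm)
    simpa only [foldFamily_singleton_foldFamily] using h

/-- Every *-homomorphism out of the noncommutative sphere induces the same map in K-theory as an
evaluation at a vertex. -/
theorem KTheoryEq.lift_vertexFamily (hn : 1 ≤ n) {F : Fin (n + 1) × Bool → B}
    (hF : IsFlagFamily (octahedralSphere n) F) (v : Fin (n + 1) × Bool) :
    KTheoryEq (FlagAlgebra.lift F hF) (FlagAlgebra.lift _ (isFlagFamily_vertexFamily v)) := by
  have : Nontrivial (Fin (n + 1)) := Fin.nontrivial_iff_two_le.2 (by omega)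
  -- With `l ≠ v.1`, the vertex `l⁺` is joined to `v` by an edge whatever the sign of `v`.
  obtain ⟨l, hl⟩ := exists_ne v.1
  exact ((KTheoryEq.foldFamily hn hF Finset.univ).trans
    (KTheoryEq.foldFamily_vertexFamily hF (Finset.mem_univ l))).trans
      (KTheoryEq.vertexFamily_vertexFamily hl)

/-- Apply the comparison to the canonical generators, whose lift is the identity. -/
theorem NCSphere.ofId_comp_eval (hn : 1 ≤ n) (v : Fin (n + 1) × Bool) :
    KTheoryEq ((StarAlgHom.ofId ℂ (NCSphere n)).comp (NCSphere.eval n v))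
      (StarAlgHom.id ℂ (NCSphere n)) := by
  have h := KTheoryEq.lift_vertexFamily hn
    (FlagAlgebra.isFlagFamily_h (K := octahedralSphere n)) v
  rw [NCFlag.lift_vertexFamily] at h
  have h1 : FlagAlgebra.lift _ (FlagAlgebra.isFlagFamily_h (K := octahedralSphere n)) =
      StarAlgHom.id ℂ (NCSphere n) :=
    FlagAlgebra.hom_ext fun s => FlagAlgebra.lift_h _ s
  rw [h1] at h
  exact h.symm

end Homotopies
end NCFlag

theorem proposition3p2 (n : ℕ) (hn : 1 ≤ n) (s : Fin (n + 1) × Bool) :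
    Function.Bijective (NCFlag.KZero.map (NCFlag.NCSphere.eval n s)) ∧
      Function.Bijective (NCFlag.KOne.map (NCFlag.NCSphere.eval n s)) := by
  obtain ⟨h0, h1⟩ := NCFlag.NCSphere.ofId_comp_eval hn s
  -- This composite is the identity exactly, not only on K-theory; so the unit map induces the
  -- two-sided inverse in both degrees.
  have h2 : (NCFlag.NCSphere.eval n s).comp (StarAlgHom.ofId ℂ (NCFlag.NCSphere n)) =
      StarAlgHom.id ℂ ℂ := StarAlgHom.ext fun z => AlgHomClass.commutes (NCFlag.NCSphere.eval n s) z
  rw [NCFlag.KZero.map_comp, NCFlag.KZero.map_id] at h0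
  rw [NCFlag.KOne.map_comp, NCFlag.KOne.map_id] at h1
  have h3 := congrArg NCFlag.KZero.map h2
  have h4 := congrArg NCFlag.KOne.map h2
  rw [NCFlag.KZero.map_comp, NCFlag.KZero.map_id] at h3
  rw [NCFlag.KOne.map_comp, NCFlag.KOne.map_id] at h4
  exact ⟨Function.bijective_iff_has_inverse.2
      ⟨_, fun x => DFunLike.congr_fun h0 x, fun x => DFunLike.congr_fun h3 x⟩,
    Function.bijective_iff_has_inverse.2
      ⟨_, fun x => DFunLike.congr_fun h1 x, fun x => DFunLike.congr_fun h4 x⟩⟩
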